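/- Let $E$ be a real vector space with a Hausdorff locally convex topology $\tau$, with topological dual $E_\tau'$, and let $\sigma:E\times E\to\mathbb{R}$ be bilinear and antisymmetric (possibly degenerate). Let $\mathcal{M}(E)$ be the closure, in the total variation norm $\|\mu\|_1=|\mu|(E)$, of the set of complex Borel measures on $E$ which are concentrated on some finite dimensional subspace. For $\hbar\in\mathbb{R}$, $\mu,\nu\in\mathcal{M}(E)$ and Borel sets $\Lambda\subseteq E$ put $$\mu\star_\hbar\nu(\Lambda)=\int_E d\mu(f)\int_E d\nu(g)\,e^{-\frac{i}{2}\hbar\sigma(f,g)}\,1_\Lambda(f+g),\qquad \mu^*(\Lambda)=\overline{\mu(-\Lambda)},\qquad \hat\mu[F]=\int_E d\mu(f)\,e^{iF(f)}\quad(F\in E_\tau');$$ then $\mu\star_\hbar\nu$ is a well-defined element of $\mathcal{M}(E)$. For each $\hbar\neq0$ let $\Pi_\hbar$ be a representation of the $*$-algebra $(\mathcal{M}(E),\star_\hbar)$, i.e. a $*$-homomorphism into the bounded operators on a complex Hilbert space $\mathcal{H}_\hbar$. Then $Q_\hbar^\Pi(\hat\mu):=\Pi_\hbar(\mu)$, $\mu\in\mathcal{M}(E)$,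 is a well-defined map on the set of functions $\{\hat\mu\mid\mu\in\mathcal{M}(E)\}$, and $\|\Pi_\hbar(\mu)\|\le\|\mu\|_1$ in operator norm. Moreover: (a) [Dirac] Let $\varsigma$ be a $\tau$-continuous semi-norm on $E$ with $|\sigma(f,g)|\le c\,\varsigma(f)\varsigma(g)$ for all $f,g\in E$ and some constant $c>0$, and let $\mathcal{M}^1_\varsigma(E)=\{\mu\in\mathcal{M}(E)\mid\int_E\varsigma(f)\,d|\mu|(f)<\infty\}$. Let $E_\varsigma$ be the completion of $E/\ker\varsigma$ in the norm induced by $\varsigma$, with dual $E_\varsigma'\subseteq E_\tau'$, and let $\sigma_\varsigma$ be the continuous extension of $\sigma$ to $E_\varsigma$, extended complex bilinearly to $E_\varsigma+iE_\varsigma$. For functions $A,B:E_\tau'\to\mathbb{C}$ having at $F\in E_\tau'$ total differentials $d_FA,d_FB\in E_\varsigma+iE_\varsigma$, defined by $d_FA(G)=\frac{d}{dt}A[F+tG]\big|_{t=0}$ for $G\in E_\varsigma'$, put $\{A,B\}[F]=-\sigma_\varsigma(d_FA,d_FB)$. Then for all $\mu,\nu\in\mathcal{M}^1_\varsigma(E)$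 the expression $\{\mu,\nu\}_0(\Lambda)=\int_E d\mu(f)\int_E d\nu(g)\,\sigma(f,g)1_\Lambda(f+g)$ is a well-defined element of $\mathcal{M}(E)$, the Poisson bracket $\{\hat\mu,\hat\nu\}$ is its Fourier transform, and $$\lim_{\hbar\to0}\Big\|\tfrac{i}{\hbar}\big(Q_\hbar^\Pi(\hat\mu)Q_\hbar^\Pi(\hat\nu)-Q_\hbar^\Pi(\hat\nu)Q_\hbar^\Pi(\hat\mu)\big)-Q_\hbar^\Pi(\{\hat\mu,\hat\nu\})\Big\|=0 .$$ (b) [von Neumann] For all $\mu,\nu\in\mathcal{M}(E)$, with the pointwise product $\hat\mu\,\hat\nu$, $$\lim_{\hbar\to0}\big\|Q_\hbar^\Pi(\hat\mu)Q_\hbar^\Pi(\hat\nu)-Q_\hbar^\Pi(\hat\mu\,\hat\nu)\big\|=0 .$$ -/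

import Mathlib

open MeasureTheory Filter Topology
open scoped ENNReal

universe u v

namespace WeylQuantization

section Measures

variable {E : Type u} [AddCommGroup E] [Module ℝ E] [MeasurableSpace E]

/-- The integral `∫ φ dμ` of a complex function against a complex measure. -/
noncomputable def cintegral (μ : ComplexMeasure E) (φ : E → ℂ) : ℂ :=
  VectorMeasure.integral μ φ (ContinuousLinearMap.mul ℝ ℂ)

/-- The complex measure `μ` is concentrated on the linear subspace `V`. -/
def ConcentratedOn (V : Submodule ℝ E) (μ : ComplexMeasure E) : Prop :=
  ∀ s : Set E, MeasurableSet s → μ (s ∩ (V : Set E)) = μ s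

theorem ConcentratedOn.mono {V W : Submodule ℝ E}
    (hW : MeasurableSet (W : Set E)) (h : V ≤ W) {μ : ComplexMeasure E}
    (hμ : ConcentratedOn V μ) : ConcentratedOn W μ := by
  intro s hs
  have h1 := hμ (s ∩ (W : Set E)) (hs.inter hW)
  have h2 : s ∩ (W : Set E) ∩ (V : Set E) = s ∩ (V : Set E) := by
    ext x
    simp only [Set.mem_inter_iff, SetLike.mem_coe]
    exact ⟨fun hx => ⟨hx.1.1, hx.2⟩, fun hx => ⟨⟨hx.1, h hx.2⟩, hx.2⟩⟩
  rw [h2, hμ s hs] at h1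
  exact h1.symm

end Measures

section Regular

variable (E : Type u) [AddCommGroup E] [Module ℝ E] [TopologicalSpace E]
  [IsTopologicalAddGroup E] [ContinuousSMul ℝ E] [T2Space E] [MeasurableSpace E] [BorelSpace E]

theorem measurableSet_finiteDimensional (V : Submodule ℝ E) [FiniteDimensional ℝ V] :
    MeasurableSet (V : Set E) :=
  V.closed_of_finiteDimensional.measurableSet

/-- The space `𝓜(E)`: the closure, in total variation norm, of the union of the spaces `𝓜(V)` of
complex Borel measures concentrated on a finite dimensional subspace `V` of `E`. -/
noncomputable def regMeasures : Submodule ℂ (ComplexMeasure E) where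
  carrier := {μ | ∀ ε : ℝ≥0∞, ε ≠ 0 → ∃ V : Submodule ℝ E, FiniteDimensional ℝ V ∧
    ∃ ν : ComplexMeasure E, ConcentratedOn V ν ∧ (μ - ν).variation Set.univ ≤ ε}
  zero_mem' := by
    intro ε _
    refine ⟨⊥, inferInstance, 0, ?_, ?_⟩
    · intro s _
      simp
    · simp
  add_mem' := by
    intro μ₁ μ₂ h₁ h₂ ε hε
    have hε2 : ε / 2 ≠ 0 := (ENNReal.half_pos hε).ne'
    obtain ⟨V₁, hV₁, ν₁, hc₁, hd₁⟩ := h₁ (ε / 2) hε2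
    obtain ⟨V₂, hV₂, ν₂, hc₂, hd₂⟩ := h₂ (ε / 2) hε2
    refine ⟨V₁ ⊔ V₂, inferInstance, ν₁ + ν₂, ?_, ?_⟩
    · intro s hs
      have a₁ := hc₁.mono
        (measurableSet_finiteDimensional E (V₁ ⊔ V₂)) le_sup_left s hs
      have a₂ := hc₂.mono
        (measurableSet_finiteDimensional E (V₁ ⊔ V₂)) le_sup_right s hs
      simp only [add_apply, a₁, a₂]
    · have e : μ₁ + μ₂ - (ν₁ + ν₂) = (μ₁ - ν₁) + (μ₂ - ν₂) := by abel
      rw [e]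
      refine (VectorMeasure.variation_add_le Set.univ).trans ?_
      rw [Measure.add_apply]
      exact (add_le_add hd₁ hd₂).trans (ENNReal.add_halves ε).le
  smul_mem' := by
    intro c μ h ε hε
    by_cases hc : c = 0
    · refine ⟨⊥, inferInstance, 0, ?_, ?_⟩
      · intro s _
        simp
      · simp [hc]
    · have hcc : ‖c‖ₑ ≠ 0 := by simpa using hc
      obtain ⟨V, hV, ν, hv, hd⟩ := h (ε / ‖c‖ₑ) (ENNReal.div_ne_zero.2 ⟨hε, enorm_ne_top⟩)
      refine ⟨V, hV, c • ν, ?_, ?_⟩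
      · intro s hs
        simp only [smul_apply, hv s hs]
      · rw [← smul_sub, VectorMeasure.variation_smul]
        calc _ = ‖c‖ₑ * (μ - ν).variation Set.univ := rfl
          _ ≤ ‖c‖ₑ * (ε / ‖c‖ₑ) := by gcongr
          _ ≤ ε := ENNReal.mul_div_le

variable {E}

/-- The total variation norm `‖μ‖₁ = |μ|(E)`. -/
noncomputable def tvNorm (μ : regMeasures E) : ℝ :=
  ((μ : ComplexMeasure E).variation Set.univ).toReal

/-- The complex measure `μ*(Λ) = conj (μ (-Λ))`. -/
noncomputable def involution (μ : ComplexMeasure E) : ComplexMeasure E :=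
  (μ.map (fun f : E => -f)).mapRange (starRingEnd ℂ).toAddMonoidHom Complex.continuous_conj

theorem involution_apply (μ : ComplexMeasure E) {s : Set E} (hs : MeasurableSet s) :
    involution μ s = starRingEnd ℂ (μ (-s)) := by
  simp only [involution, VectorMeasure.mapRange_apply]
  rw [VectorMeasure.map_apply _ continuous_neg.measurable hs]
  rfl

theorem measurableSet_negate {s : Set E} (hs : MeasurableSet s) : MeasurableSet (-s) :=
  continuous_neg.measurable hs

theorem involution_mem {μ : ComplexMeasure E} (hμ : μ ∈ regMeasures E) :
    involution μ ∈ regMeasures E := by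
  intro ε hε
  obtain ⟨V, hV, ν, hc, hd⟩ := hμ ε hε
  refine ⟨V, hV, involution ν, ?_, ?_⟩
  · intro s hs
    have hVm := measurableSet_finiteDimensional E V
    rw [involution_apply _ (hs.inter hVm), involution_apply _ hs]
    have : -(s ∩ (V : Set E)) = -s ∩ (V : Set E) := by
      ext x
      simp
    rw [this, hc _ (measurableSet_negate hs)]
  · refine le_trans ?_ hd
    have key : (involution μ - involution ν).variation ≤
        ((μ - ν).variation.map (fun f : E => -f)) := by
      refine VectorMeasure.variation_le_of_forall_enorm_le ?_
      intro s hs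
      rw [sub_apply, involution_apply _ hs, involution_apply _ hs, ← map_sub,
        ← sub_apply, Measure.map_apply continuous_neg.measurable hs]
      have h1 : ‖starRingEnd ℂ ((μ - ν) (-s))‖ₑ = ‖(μ - ν) (-s)‖ₑ := by
        rw [← ofReal_norm, ← ofReal_norm, RCLike.norm_conj]
      rw [h1]
      exact VectorMeasure.enorm_measure_le_variation _ _
    refine (key Set.univ).trans ?_
    rw [Measure.map_apply continuous_neg.measurable MeasurableSet.univ]
    simp

/-- The involution `μ ↦ μ*` on `𝓜(E)`. -/
noncomputable def invol (μ : regMeasures E) : regMeasures E :=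
  ⟨involution (μ : ComplexMeasure E), involution_mem μ.2⟩

/-- `ρ(Λ) = ∫ dμ(f) ∫ dν(g) w(f,g) Λ(f+g)` for all Borel sets `Λ`, where `Λ(·)` is the
characteristic function of `Λ`. -/
def IsWeightedConv (w : E → E → ℂ) (μ ν ρ : regMeasures E) : Prop :=
  ∀ s : Set E, MeasurableSet s →
    (ρ : ComplexMeasure E) s =
      cintegral (μ : ComplexMeasure E) fun f =>
        cintegral (ν : ComplexMeasure E) fun g => w f g * s.indicator (fun _ => (1 : ℂ)) (f + g)

open Classical in
/-- The measure in `𝓜(E)` given by `Λ ↦ ∫ dμ(f) ∫ dν(g) w(f,g) Λ(f+g)`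
(it is unique; by convention it is `0` if there is none). -/
noncomputable def weightedConv (w : E → E → ℂ) (μ ν : regMeasures E) : regMeasures E :=
  if h : ∃ ρ : regMeasures E, IsWeightedConv w μ ν ρ then h.choose else 0

/-- The weight `exp (- (i/2) ħ σ(f,g))`. -/
noncomputable def multiplier (σ : LinearMap.BilinForm ℝ E) (ħ : ℝ) (f g : E) : ℂ :=
  Complex.exp (-(Complex.I / 2) * (ħ : ℂ) * ((σ f g : ℝ) : ℂ))

/-- The twisted convolution `μ ⋆_ħ ν`. -/
noncomputable def twistedConv (σ : LinearMap.BilinForm ℝ E) (ħ : ℝ) (μ ν : regMeasures E) :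
    regMeasures E :=
  weightedConv (multiplier σ ħ) μ ν

/-- The Poisson bracket of measures `{μ,ν}₀(Λ) = ∫ dμ(f) ∫ dν(g) σ(f,g) Λ(f+g)`. -/
noncomputable def measureBracket (σ : LinearMap.BilinForm ℝ E) (μ ν : regMeasures E) :
    regMeasures E :=
  weightedConv (fun f g => ((σ f g : ℝ) : ℂ)) μ ν

/-- The moment spaces `𝓜ⁿ_κ(E)` for a semi-norm `κ` and `n ∈ ℕ ∪ {∞}`. -/
def momentMeasures (κ : Seminorm ℝ E) (n : ℕ∞) : Set (regMeasures E) :=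
  {μ | ∀ m : ℕ, (m : ℕ∞) ≤ n →
    ∫⁻ f, ENNReal.ofReal (κ f ^ m) ∂(μ : ComplexMeasure E).variation < ∞}

/-- The Fourier transform `μ̂[F] = ∫ dμ(f) exp (i F(f))`, a function on the phase space, which is
the topological dual of `E`. -/
noncomputable def measureFourier (μ : regMeasures E) : StrongDual ℝ E → ℂ :=
  fun F => cintegral (μ : ComplexMeasure E) fun f => Complex.exp (Complex.I * ((F f : ℝ) : ℂ))

/-- A representation of the `*`-algebra `(𝓜(E), ⋆_ħ)`: a `*`-homomorphism into the bounded
operators on a complex Hilbert space `H` (not assumed to be non-degenerate). -/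
structure MeasureRep (σ : LinearMap.BilinForm ℝ E) (ħ : ℝ) (H : Type v) [NormedAddCommGroup H]
    [InnerProductSpace ℂ H] [CompleteSpace H] where
  toLinearMap : regMeasures E →ₗ[ℂ] (H →L[ℂ] H)
  map_conv : ∀ μ ν : regMeasures E,
    toLinearMap (twistedConv σ ħ μ ν) = toLinearMap μ * toLinearMap ν
  map_invol : ∀ μ : regMeasures E,
    toLinearMap (invol μ) = ContinuousLinearMap.adjoint (toLinearMap μ)

open Classical in
/-- The quantization map `Q(μ̂) = Π(μ)`, defined on phase space functions of the form `μ̂` with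
`μ ∈ 𝓜(E)` (and `0` on all other functions). -/
noncomputable def quantMap {σ : LinearMap.BilinForm ℝ E} {ħ : ℝ} {H : Type v}
    [NormedAddCommGroup H] [InnerProductSpace ℂ H] [CompleteSpace H] (P : MeasureRep σ ħ H)
    (A : StrongDual ℝ E → ℂ) : H →L[ℂ] H :=
  if h : ∃ μ : regMeasures E, measureFourier μ = A then P.toLinearMap h.choose else 0

/-- The `ħ`-scaled commutator `(i/ħ)(AB - BA)`. -/
noncomputable def scaledCommutator {H : Type v} [NormedAddCommGroup H] [InnerProductSpace ℂ H]
    (ħ : ℝ) (A B : H →L[ℂ] H) : H →L[ℂ] H :=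
  (Complex.I / (ħ : ℂ)) • (A * B - B * A)

end Regular

section Geometry

/-- A copy of `E`, to be topologized by the semi-norm `ς` alone. -/
def SeminormSpace {E : Type u} [AddCommGroup E] [Module ℝ E] (_ς : Seminorm ℝ E) : Type u := E

variable {E : Type u} [AddCommGroup E] [Module ℝ E]

noncomputable instance (ς : Seminorm ℝ E) : SeminormedAddCommGroup (SeminormSpace ς) :=
  AddGroupSeminorm.toSeminormedAddCommGroup (E := E) ς.toAddGroupSeminorm

noncomputable instance (ς : Seminorm ℝ E) : Module ℝ (SeminormSpace ς) :=
  inferInstanceAs (Module ℝ E)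

noncomputable instance (ς : Seminorm ℝ E) : NormedSpace ℝ (SeminormSpace ς) where
  norm_smul_le a x := (map_smul_eq_mul ς a (x : E)).le

/-- The Banach space `E_ς`, the (Hausdorff) completion of `E` with respect to the semi-norm `ς`,
that is, the completion of `E / ker ς`. -/
abbrev SeminormCompletion (ς : Seminorm ℝ E) : Type u :=
  UniformSpace.Completion (SeminormSpace ς)

/-- The linear map `f ↦ [f]` from `E` to `E_ς`. -/
noncomputable def toCompletion (ς : Seminorm ℝ E) : E →ₗ[ℝ] SeminormCompletion ς where
  toFun f := ((show SeminormSpace ς from f : SeminormSpace ς) : SeminormCompletion ς)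
  map_add' f g := UniformSpace.Completion.coe_add (α := SeminormSpace ς) f g
  map_smul' a f := UniformSpace.Completion.coe_smul (X := SeminormSpace ς) a f

theorem norm_toCompletion (ς : Seminorm ℝ E) (f : E) : ‖toCompletion ς f‖ = ς f :=
  UniformSpace.Completion.norm_coe (E := SeminormSpace ς) f

/-- The complex bilinear extension to `V + i V` of a real bilinear form on `V`; the pair
`(φ₁, φ₂)` stands for `φ₁ + i φ₂`. -/
noncomputable def complexForm {V : Type u} [NormedAddCommGroup V] [NormedSpace ℝ V]
    (s : V →L[ℝ] V →L[ℝ] ℝ) (a b : V × V) : ℂ :=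
  ((s a.1 b.1 : ℝ) : ℂ) + Complex.I * ((s a.1 b.2 : ℝ) : ℂ)
    + Complex.I * ((s a.2 b.1 : ℝ) : ℂ) - ((s a.2 b.2 : ℝ) : ℂ)

/-- `σ` as a continuous bilinear form for the semi-norm `ς`. -/
noncomputable def seminormForm (σ : LinearMap.BilinForm ℝ E) (ς : Seminorm ℝ E) (c : ℝ)
    (hc : ∀ f g, |σ f g| ≤ c * ς f * ς g) :
    SeminormSpace ς →L[ℝ] SeminormSpace ς →L[ℝ] ℝ :=
  LinearMap.mkContinuous₂ (show SeminormSpace ς →ₗ[ℝ] SeminormSpace ς →ₗ[ℝ] ℝ from σ) c hc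

/-- The continuous bilinear extension `σ_ς` of `σ` to `E_ς`, with `σ_ς([f],[g]) = σ(f,g)`. -/
noncomputable def completedForm (σ : LinearMap.BilinForm ℝ E) (ς : Seminorm ℝ E) (c : ℝ)
    (hc : ∀ f g, |σ f g| ≤ c * ς f * ς g) :
    SeminormCompletion ς →L[ℝ] SeminormCompletion ς →L[ℝ] ℝ :=
  (((seminormForm σ ς c hc).extend
      (UniformSpace.Completion.toComplL (𝕜 := ℝ) (E := SeminormSpace ς))).flip.extend
      (UniformSpace.Completion.toComplL (𝕜 := ℝ) (E := SeminormSpace ς))).flip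

theorem completedForm_apply (σ : LinearMap.BilinForm ℝ E) (ς : Seminorm ℝ E) (c : ℝ)
    (hc : ∀ f g, |σ f g| ≤ c * ς f * ς g) (f g : E) :
    completedForm σ ς c hc (toCompletion ς f) (toCompletion ς g) = σ f g := by
  have hd : DenseRange (UniformSpace.Completion.toComplL (𝕜 := ℝ) (E := SeminormSpace ς)) :=
    UniformSpace.Completion.denseRange_coe
  have hi : IsUniformInducing
      (UniformSpace.Completion.toComplL (𝕜 := ℝ) (E := SeminormSpace ς)) :=
    UniformSpace.Completion.isUniformInducing_coe (SeminormSpace ς)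
  have h1 := ContinuousLinearMap.extend_eq (f := ((seminormForm σ ς c hc).extend
      (UniformSpace.Completion.toComplL (𝕜 := ℝ) (E := SeminormSpace ς))).flip) hd hi
      (show SeminormSpace ς from g)
  have h2 := ContinuousLinearMap.extend_eq (f := seminormForm σ ς c hc) hd hi
      (show SeminormSpace ς from f)
  have h3 := congrArg (fun T => T (toCompletion ς f)) h1
  have h4 := congrArg (fun T => T (show SeminormSpace ς from g)) h2
  exact h3.trans h4

variable [TopologicalSpace E] [IsTopologicalAddGroup E]

/-- For continuous `ς` the map `f ↦ [f]` is continuous. -/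
noncomputable def toCompletionL (ς : Seminorm ℝ E) (hς : Continuous ς) :
    E →L[ℝ] SeminormCompletion ς where
  toLinearMap := toCompletion ς
  cont := by
    refine continuous_of_continuousAt_zero (toCompletion ς).toAddMonoidHom ?_
    change Tendsto (toCompletion ς) (𝓝 0) (𝓝 (toCompletion ς 0))
    rw [map_zero, tendsto_zero_iff_norm_tendsto_zero]
    simp only [norm_toCompletion]
    simpa using hς.tendsto 0

/-- `(φ₁, φ₂)`, standing for `φ₁ + i φ₂ ∈ E_ς + i E_ς`, is the total differential of
`A` at the phase space point `F` along the directions `G ∈ E_ς'`: here `Γ` runs over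
the dual of `E_ς`, and `G = Γ([·])` is the corresponding functional on `E`. -/
def IsTotalDifferential (ς : Seminorm ℝ E) (hς : Continuous ς) (A : StrongDual ℝ E → ℂ)
    (F : StrongDual ℝ E) (φ : SeminormCompletion ς × SeminormCompletion ς) : Prop :=
  ∀ Γ : StrongDual ℝ (SeminormCompletion ς),
    HasDerivAt (fun t : ℝ => A (F + t • Γ.comp (toCompletionL ς hς)))
      (((Γ φ.1 : ℝ) : ℂ) + Complex.I * ((Γ φ.2 : ℝ) : ℂ)) 0

open Classical in
/-- The total differential `d_F A` as a pair of elements of `E_ς`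
(it is unique; by convention it is `0` if there is none). -/
noncomputable def totalDifferential (ς : Seminorm ℝ E) (hς : Continuous ς)
    (A : StrongDual ℝ E → ℂ) (F : StrongDual ℝ E) :
    SeminormCompletion ς × SeminormCompletion ς :=
  if h : ∃ φ, IsTotalDifferential ς hς A F φ then h.choose else 0

/-- The Poisson bracket of phase space functions, `{A,B}[F] = Σ_F(d_F A, d_F B)`, where `Σ_F` is
the complex bilinear extension of `-σ_ς`. -/
noncomputable def poissonBracket (σ : LinearMap.BilinForm ℝ E) (ς : Seminorm ℝ E)
    (hς : Continuous ς) (c : ℝ) (hc : ∀ f g, |σ f g| ≤ c * ς f * ς g)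
    (A B : StrongDual ℝ E → ℂ) : StrongDual ℝ E → ℂ := fun F =>
  -complexForm (completedForm σ ς c hc) (totalDifferential ς hς A F) (totalDifferential ς hς B F)

end Geometry

end WeylQuantization

open WeylQuantization

namespace WeylQuantization

/-! ### Integration against complex measures through the polar decomposition. -/

section ComplexMeasures

variable {X : Type*} {mX : MeasurableSpace X}

/-! Both limits are total variation estimates. A convolution of `μ` and `ν` with weight `w` has norm
at most `∫∫ |w| d|μ| d|ν|` (`tvNorm_weightedConv_le`), and every representation is contractive for
the total variation norm (`MeasureRep.norm_le`): `𝓜(E)` with `⋆_ħ` is a unital Banach algebra, a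
homomorphism does not enlarge spectra beyond `0`, and the norm of a self-adjoint operator is its
spectral radius. The von Neumann difference is `Π_ħ` of the convolution with weight `exp(-iħσ/2) -
1`, the Dirac difference is `Π_ħ` of the one with weight `(2/ħ) sin(ħσ/2) - σ`. These weights tend
to `0` pointwise and are dominated by `2` and by `2|σ|`; the latter is integrable by the first
moment condition. Dominated convergence concludes.

The delicate point is measurability: `σ` need not be continuous, and even addition may fail to be
measurable for the product σ-algebra of `E × E`. However, each measure in `𝓜(E)` is concentrated on
an increasing union `S` of countably many finite dimensional subspaces (`exists_concentratedOn`),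
and on `S × S` both maps are measurable (`IsSigmaFinDim.measurable_restrict`). Convolutions are
therefore formed on `S` and pushed forward to `E`.

The quantization map is well defined because the Fourier transform is injective on `𝓜(E)`
(`measureFourier_injective`), which local convexity reduces to uniqueness in finite dimension. For
the Poisson bracket, the differential of `μ̂` at `F` is the Bochner integral of `i exp(iF(f)) [f]`
against `μ`; the continuous form `σ_ς` passes under two such integrals
(`poissonBracket_measureFourier`). -/

instance instIsFiniteMeasureVariationSigned (s : SignedMeasure X) :
    IsFiniteMeasure s.variation := by
  rw [← SignedMeasure.totalVariation_eq_variation, SignedMeasure.totalVariation]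
  infer_instance

instance instIsFiniteMeasureVariationComplex (μ : ComplexMeasure X) :
    IsFiniteMeasure μ.variation := by
  refine isFiniteMeasure_of_le
    ((ComplexMeasure.re μ).variation + (ComplexMeasure.im μ).variation) ?_
  refine VectorMeasure.variation_le_of_forall_enorm_le fun s _ => ?_
  calc ‖μ s‖ₑ ≤ ‖(μ s).re‖ₑ + ‖(μ s).im‖ₑ := by
        rw [← ofReal_norm, ← ofReal_norm, ← ofReal_norm,
          ← ENNReal.ofReal_add (norm_nonneg _) (norm_nonneg _)]
        exact ENNReal.ofReal_le_ofReal (Complex.norm_le_abs_re_add_abs_im _)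
    _ ≤ (ComplexMeasure.re μ).variation s + (ComplexMeasure.im μ).variation s :=
        add_le_add (VectorMeasure.enorm_measure_le_variation (ComplexMeasure.re μ) s)
          (VectorMeasure.enorm_measure_le_variation (ComplexMeasure.im μ) s)

/-- The polar decomposition of a complex measure. -/
theorem exists_phase (μ : ComplexMeasure X) : ∃ u : X → ℂ, Measurable u ∧ (∀ x, ‖u x‖ = 1) ∧
    μ.variation.withDensityᵥ u = μ := by
  have hre : ComplexMeasure.re μ ≪ᵥ μ.variation.toENNRealVectorMeasure := by
    intro s hs
    exact congrArg Complex.re (VectorMeasure.absolutelyContinuous μ hs)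
  have him : ComplexMeasure.im μ ≪ᵥ μ.variation.toENNRealVectorMeasure := by
    intro s hs
    exact congrArg Complex.im (VectorMeasure.absolutelyContinuous μ hs)
  have h1 := SignedMeasure.withDensityᵥ_rnDeriv_eq _ _ hre
  have h2 := SignedMeasure.withDensityᵥ_rnDeriv_eq _ _ him
  set a := (ComplexMeasure.re μ).rnDeriv μ.variation
  set b := (ComplexMeasure.im μ).rnDeriv μ.variation
  have ha : Measurable a := SignedMeasure.measurable_rnDeriv _ _
  have hb : Measurable b := SignedMeasure.measurable_rnDeriv _ _
  have hai : Integrable a μ.variation := SignedMeasure.integrable_rnDeriv _ _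
  have hbi : Integrable b μ.variation := SignedMeasure.integrable_rnDeriv _ _
  let θ : X → ℂ := fun x => (a x : ℂ) + (b x : ℂ) * Complex.I
  have hθm : Measurable θ := by fun_prop
  have hθi : Integrable θ μ.variation := hai.ofReal.add (hbi.ofReal.mul_const _)
  have hμ : μ.variation.withDensityᵥ θ = μ := by
    ext s hs
    rw [withDensityᵥ_apply hθi hs, integral_add hai.ofReal.restrict
      (hbi.ofReal.mul_const _).restrict, integral_mul_const, integral_complex_ofReal,
      integral_complex_ofReal, ← withDensityᵥ_apply hai hs, ← withDensityᵥ_apply hbi hs, h1, h2]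
    exact Complex.re_add_im (μ s)
  -- The variation of `θ|μ|` is `|θ||μ|`. As `θ|μ|` is `μ`, this is `|μ|` again, which forces `|θ| =
  -- 1` almost everywhere.
  have hv : μ.variation.withDensity (fun x => ‖θ x‖ₑ) = μ.variation := by
    rw [← Measure.variation_withDensityᵥ hθi, hμ]
  have hone : (fun x => ‖θ x‖ₑ) =ᵐ[μ.variation] 1 := by
    rw [← withDensity_eq_iff (by fun_prop) (by fun_prop), hv, withDensity_one]
    exact hθi.2.ne
  have hset : MeasurableSet {x | ‖θ x‖ = 1} := measurableSet_eq_fun (by fun_prop) (by fun_prop)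
  classical
  -- Changing `θ` on a null set gives modulus one everywhere, which spares later almost-everywhere
  -- arguments.
  refine ⟨fun x => if ‖θ x‖ = 1 then θ x else 1, Measurable.ite hset hθm measurable_const,
    fun x => ?_, ?_⟩
  · by_cases h : ‖θ x‖ = 1 <;> simp [h]
  · rw [← WithDensityᵥEq.congr_ae (f := θ), hμ]
    filter_upwards [hone] with x hx
    have : ‖θ x‖ = 1 := by
      rw [← toReal_enorm, hx]; simp
    simp [this]

/-- The phase of a complex measure, a measurable function of modulus `1`. -/
noncomputable def phase (μ : ComplexMeasure X) : X → ℂ := (exists_phase μ).choose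

@[fun_prop]
theorem measurable_phase (μ : ComplexMeasure X) : Measurable (phase μ) :=
  (exists_phase μ).choose_spec.1

@[simp]
theorem norm_phase (μ : ComplexMeasure X) (x : X) : ‖phase μ x‖ = 1 :=
  (exists_phase μ).choose_spec.2.1 x

theorem withDensityᵥ_phase (μ : ComplexMeasure X) :
    μ.variation.withDensityᵥ (phase μ) = μ :=
  (exists_phase μ).choose_spec.2.2

theorem integrable_phase (μ : ComplexMeasure X) : Integrable (phase μ) μ.variation :=
  Integrable.of_bound (measurable_phase μ).aestronglyMeasurable 1 (by simp)

/-- Both sides are continuous in `φ` for the `L¹` norm of `|θ|m`, the variation of `θm`, and they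
agree on indicators; induction on integrable functions does the rest. -/
theorem cintegral_withDensityᵥ {m : Measure X} {θ φ : X → ℂ} (hθm : Measurable θ)
    (hθ : Integrable θ m) (hφ : Integrable (fun x => φ x * θ x) m) :
    cintegral (m.withDensityᵥ θ) φ = ∫ x, φ x * θ x ∂m := by
  set n := m.withDensity (fun x => ‖θ x‖ₑ) with hn
  have hv : (m.withDensityᵥ θ).variation = n := Measure.variation_withDensityᵥ hθ
  have hfin : IsFiniteMeasure n := hv ▸ inferInstance
  have hint : ∀ ψ : X → ℂ, Integrable ψ n ↔ Integrable (fun x => ‖θ x‖ • ψ x) m := by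
    intro ψ
    rw [hn, integrable_withDensity_iff_integrable_smul' (by fun_prop) (by simp)]
    simp
  have hintg : ∀ ψ : X → ℂ, ∫ x, ψ x ∂n = ∫ x, ‖θ x‖ • ψ x ∂m := by
    intro ψ
    rw [hn, integral_withDensity_eq_integral_toReal_smul (by fun_prop) (by simp)]
    simp
  have hsplit : ∀ ψ : X → ℂ,
      (fun x => ψ x * θ x) = fun x => ‖θ x‖ • (ψ x * (θ x / (‖θ x‖ : ℂ))) := by
    intro ψ
    ext x
    by_cases h : θ x = 0
    · simp [h]
    · have : (‖θ x‖ : ℂ) ≠ 0 := by simpa using h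
      rw [Complex.real_smul]
      field_simp
  -- The phase of `θ`, equal to `0` where `θ` vanishes because `0 / 0 = 0`. Being bounded, it makes
  -- the right side a continuous functional on `L¹`.
  let κ : X → ℂ := fun x => θ x / (‖θ x‖ : ℂ)
  have hκm : Measurable κ := by fun_prop
  have hκ : ∀ x, ‖κ x‖ ≤ 1 := by
    intro x
    simp only [κ, norm_div, Complex.norm_real, norm_norm]
    exact div_self_le_one _
  have hgoal : ∀ ψ : X → ℂ, ∫ x, ψ x * θ x ∂m = ∫ x, ψ x * κ x ∂n := by
    intro ψ
    rw [hsplit, hintg]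
  rw [hgoal]
  have hφn : Integrable φ n := by
    rw [hint]
    have hns : (fun x => ‖θ x‖ • φ x) = fun x => (φ x * θ x) * ((‖θ x‖ : ℂ) / θ x) := by
      ext x
      by_cases h : θ x = 0
      · simp [h]
      · rw [Complex.real_smul]
        field_simp
    rw [hns]
    refine Integrable.mul_bdd (c := 1) hφ (Measurable.aestronglyMeasurable (by fun_prop)) (ae_of_all _ fun x => ?_)
    simp only [norm_div, Complex.norm_real, norm_norm]
    exact div_self_le_one _
  have hmk : ∀ ψ : X → ℂ, Integrable ψ n → Integrable (fun x => ψ x * κ x) n := fun ψ hψ =>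
    hψ.mul_bdd (c := 1) hκm.aestronglyMeasurable (ae_of_all _ hκ)
  clear hφ
  unfold cintegral
  refine Integrable.induction (P := fun φ => VectorMeasure.integral (m.withDensityᵥ θ) φ
    (ContinuousLinearMap.mul ℝ ℂ) = ∫ x, φ x * κ x ∂n) ?_ ?_ ?_ ?_ hφn
  · intro c s hs _
    rw [VectorMeasure.integral_indicator hs, VectorMeasure.setIntegral_const, ← hgoal,
      withDensityᵥ_apply hθ hs, ContinuousLinearMap.mul_apply', ← integral_const_mul,
      ← integral_indicator hs]
    congr 1
    ext x
    by_cases h : x ∈ s <;> simp [h]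
  · intro f g _ hf hg ihf ihg
    rw [VectorMeasure.integral_add (by rwa [VectorMeasure.Integrable, hv])
      (by rwa [VectorMeasure.Integrable, hv]), ihf, ihg, ← integral_add (hmk f hf) (hmk g hg)]
    simp [add_mul]
  · have hc : Continuous fun f : Lp ℂ 1 n => ∫ x, f x * κ x ∂n := by
      refine LipschitzWith.continuous (K := 1) (LipschitzWith.mk_one fun f g => ?_)
      rw [dist_eq_norm, dist_eq_norm, L1.norm_eq_integral_norm, ← integral_sub
        (hmk f (L1.integrable_coeFn f)) (hmk g (L1.integrable_coeFn g))]
      refine norm_integral_le_of_norm_le (L1.integrable_coeFn (f - g)).norm ?_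
      filter_upwards [Lp.coeFn_sub f g] with x hx
      rw [← sub_mul, norm_mul, hx]
      exact mul_le_of_le_one_right (norm_nonneg _) (hκ x)
    rw [← hv] at hc ⊢
    exact isClosed_eq VectorMeasure.continuous_integral hc
  · intro f g hfg hf h
    rw [← integral_congr_ae (f := fun x => f x * κ x), ← h]
    · exact VectorMeasure.integral_congr_ae (by rw [hv]; exact hfg.symm)
    · filter_upwards [hfg] with x hx
      rw [hx]

/-- No integrability is assumed: the phase has modulus one, so both integrands are integrable or
neither is, and in the second case both integrals default to `0`. -/
theorem cintegral_eq_integral (μ : ComplexMeasure X) (φ : X → ℂ) :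
    cintegral μ φ = ∫ x, φ x * phase μ x ∂μ.variation := by
  have hiff : Integrable (fun x => φ x * phase μ x) μ.variation ↔ Integrable φ μ.variation := by
    refine ⟨fun h => ?_, fun h => h.mul_bdd (c := 1)
      (measurable_phase μ).aestronglyMeasurable (ae_of_all _ fun x => by simp)⟩
    have h' := h.mul_bdd (c := 1) (g := fun x => (phase μ x)⁻¹)
      (measurable_phase μ).inv.aestronglyMeasurable (ae_of_all _ fun x => by simp)
    refine h'.congr (ae_of_all _ fun x => ?_)
    have : phase μ x ≠ 0 := by
      rw [← norm_ne_zero_iff]; simp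
    simp [this]
  by_cases h : Integrable φ μ.variation
  · conv_lhs => rw [← withDensityᵥ_phase μ]
    exact cintegral_withDensityᵥ (measurable_phase μ) (integrable_phase μ) (hiff.2 h)
  · rw [integral_undef (hiff.not.2 h), cintegral, VectorMeasure.integral_undef h]

theorem cintegral_const_mul (μ : ComplexMeasure X) (c : ℂ) (φ : X → ℂ) :
    cintegral μ (fun x => c * φ x) = c * cintegral μ φ := by
  simp only [cintegral_eq_integral, mul_assoc, integral_const_mul]

theorem cintegral_indicator_one (μ : ComplexMeasure X) {s : Set X} (hs : MeasurableSet s) :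
    cintegral μ (s.indicator fun _ => 1) = μ s := by
  rw [cintegral, VectorMeasure.integral_indicator hs, VectorMeasure.setIntegral_const]
  simp

theorem norm_cintegral_le (μ : ComplexMeasure X) {φ : X → ℂ} {C : ℝ} (h : ∀ x, ‖φ x‖ ≤ C) :
    ‖cintegral μ φ‖ ≤ C * μ.variation.real Set.univ := by
  rw [cintegral_eq_integral]
  exact norm_integral_le_of_norm_le_const (ae_of_all _ fun x => by simpa using h x)

theorem cintegral_add_measure {μ ν : ComplexMeasure X} {φ : X → ℂ}
    (hμ : Integrable φ μ.variation) (hν : Integrable φ ν.variation) :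
    cintegral (μ + ν) φ = cintegral μ φ + cintegral ν φ :=
  VectorMeasure.integral_add_vectorMeasure hμ hν

theorem cintegral_smul_measure (c : ℂ) {μ : ComplexMeasure X} {φ : X → ℂ}
    (hμ : Integrable φ μ.variation) : cintegral (c • μ) φ = c * cintegral μ φ := by
  have hi : Integrable (fun x => φ x * phase μ x) μ.variation :=
    hμ.mul_bdd (c := 1) (measurable_phase μ).aestronglyMeasurable (ae_of_all _ fun x => by simp)
  have hc : c • μ = μ.variation.withDensityᵥ fun x => c * phase μ x := by
    conv_lhs => rw [← withDensityᵥ_phase μ]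
    rw [← withDensityᵥ_smul]
    rfl
  rw [hc, cintegral_withDensityᵥ (by fun_prop) ((integrable_phase μ).const_mul c),
    cintegral_eq_integral, ← integral_const_mul]
  · congr 1
    ext x
    ring
  · refine (hi.const_mul c).congr (ae_of_all _ fun x => ?_)
    ring

theorem cintegral_map_of_embedding {Y : Type*} [MeasurableSpace Y] {j : X → Y}
    (hj : MeasurableEmbedding j) (μ : ComplexMeasure X) (φ : Y → ℂ) :
    cintegral (μ.map j) φ = cintegral μ (fun x => φ (j x)) :=
  hj.integral_map_vectorMeasure

theorem cintegral_map {Y : Type*} [MeasurableSpace Y] {a : X → Y} (ha : Measurable a)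
    (μ : ComplexMeasure X) {φ : Y → ℂ} (hφ : Measurable φ) {C : ℝ} (hC : ∀ y, ‖φ y‖ ≤ C) :
    cintegral (μ.map a) φ = cintegral μ (fun x => φ (a x)) :=
  VectorMeasure.integral_map ha hφ.aestronglyMeasurable
    (Integrable.of_bound (hφ.comp ha).aestronglyMeasurable C (ae_of_all _ fun x => hC (a x)))

theorem measurable_cintegral_right {Y : Type*} [MeasurableSpace Y] (ν : ComplexMeasure Y)
    {k : X → Y → ℂ} (hk : Measurable (Function.uncurry k)) :
    Measurable fun x => cintegral ν (k x) := by
  simp only [cintegral_eq_integral]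
  refine (StronglyMeasurable.integral_prod_right (f := fun x y => k x y * phase ν y)
    (Measurable.stronglyMeasurable ?_)).measurable
  exact hk.mul ((measurable_phase ν).comp measurable_snd)

theorem cintegral_cintegral {Y : Type*} [MeasurableSpace Y] {μ : ComplexMeasure X}
    {ν : ComplexMeasure Y} {k : X → Y → ℂ}
    (hk : Integrable (Function.uncurry k) (μ.variation.prod ν.variation)) :
    cintegral μ (fun x => cintegral ν (k x)) =
      ∫ p, k p.1 p.2 * (phase μ p.1 * phase ν p.2) ∂μ.variation.prod ν.variation := by
  rw [integral_prod, cintegral_eq_integral]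
  · congr 1
    ext x
    rw [cintegral_eq_integral, ← integral_mul_const]
    congr 1
    ext y
    ring
  · refine Integrable.mul_bdd (c := 1) hk ?_ (ae_of_all _ fun p => by simp)
    exact Measurable.aestronglyMeasurable (by fun_prop)

/-- Reduces complex measures to four finite positive ones, for which uniqueness of characteristic
functions is available. -/
theorem cintegral_eq_integral_jordan (μ : ComplexMeasure X) {φ : X → ℂ} (hφ : Measurable φ)
    {C : ℝ} (hC : ∀ x, ‖φ x‖ ≤ C) :
    cintegral μ φ =
      (∫ x, φ x ∂(ComplexMeasure.re μ).toJordanDecomposition.posPart -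
        ∫ x, φ x ∂(ComplexMeasure.re μ).toJordanDecomposition.negPart) +
      Complex.I * (∫ x, φ x ∂(ComplexMeasure.im μ).toJordanDecomposition.posPart -
        ∫ x, φ x ∂(ComplexMeasure.im μ).toJordanDecomposition.negPart) := by
  set p := (ComplexMeasure.re μ).toJordanDecomposition with hp
  set q := (ComplexMeasure.im μ).toJordanDecomposition with hq
  have hint : ∀ ν : ComplexMeasure X, Integrable φ ν.variation := fun ν =>
    Integrable.of_bound hφ.aestronglyMeasurable C (ae_of_all _ hC)
  have hone : ∀ (m : Measure X) [IsFiniteMeasure m],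
      cintegral (m.withDensityᵥ fun _ => (1 : ℂ)) φ = ∫ x, φ x ∂m := by
    intro m _
    rw [cintegral_withDensityᵥ measurable_const (integrable_const _)]
    · simp
    · simpa using Integrable.of_bound hφ.aestronglyMeasurable C (ae_of_all m hC)
  have hdens : ∀ (m : Measure X) [IsFiniteMeasure m] {s : Set X}, MeasurableSet s →
      (m.withDensityᵥ fun _ => (1 : ℂ)) s = (m.toSignedMeasure s : ℂ) := by
    intro m _ s hs
    rw [withDensityᵥ_apply (integrable_const _) hs,
      Measure.toSignedMeasure_apply_measurable hs]
    simp
  have hμ : μ = (p.posPart.withDensityᵥ (fun _ => (1 : ℂ)) +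
      (-1 : ℂ) • p.negPart.withDensityᵥ fun _ => (1 : ℂ)) +
      Complex.I • (q.posPart.withDensityᵥ (fun _ => (1 : ℂ)) +
        (-1 : ℂ) • q.negPart.withDensityᵥ fun _ => (1 : ℂ)) := by
    ext s hs
    have h1 : (μ s).re = p.toSignedMeasure s := by
      rw [hp, SignedMeasure.toSignedMeasure_toJordanDecomposition]
      rfl
    have h2 : (μ s).im = q.toSignedMeasure s := by
      rw [hq, SignedMeasure.toSignedMeasure_toJordanDecomposition]
      rfl
    simp only [add_apply, smul_apply, hdens _ hs, smul_eq_mul]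
    rw [← Complex.re_add_im (μ s), h1, h2, JordanDecomposition.toSignedMeasure,
      JordanDecomposition.toSignedMeasure, sub_apply, sub_apply]
    push_cast
    ring
  conv_lhs => rw [hμ]
  rw [cintegral_add_measure (hint _) (hint _), cintegral_smul_measure _ (hint _),
    cintegral_add_measure (hint _) (hint _), cintegral_add_measure (hint _) (hint _),
    cintegral_smul_measure _ (hint _), cintegral_smul_measure _ (hint _)]
  simp only [hone]
  ring

end ComplexMeasures

/-! ### Weighted convolution on a group with measurable addition. -/

section GroupConvolution

variable {G : Type*} [AddCommGroup G] [MeasurableSpace G]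
  {w : G → G → ℂ} {μ ν κ : ComplexMeasure G}

theorem norm_indicator_one_le {X : Type*} (s : Set X) (x : X) :
    ‖s.indicator (fun _ => (1 : ℂ)) x‖ ≤ 1 :=
  (norm_indicator_le_norm_self _ _).trans (by simp)

theorem norm_cintegral_mul_indicator_le {C : ℝ} (hC : ∀ f g, ‖w f g‖ ≤ C)
    (ν : ComplexMeasure G) (s : Set G) (f : G) :
    ‖cintegral ν fun g => w f g * s.indicator (fun _ => 1) (f + g)‖ ≤
      C * ν.variation.real Set.univ := by
  refine norm_cintegral_le _ fun y => ?_
  rw [norm_mul]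
  exact (mul_le_of_le_one_right (norm_nonneg _) (norm_indicator_one_le s _)).trans (hC f y)

theorem integrable_mul_phase_mul_phase {X Y : Type*} [MeasurableSpace X] [MeasurableSpace Y]
    {μ : ComplexMeasure X} {ν : ComplexMeasure Y} {k : X × Y → ℂ}
    (hk : Integrable k (μ.variation.prod ν.variation)) :
    Integrable (fun p => k p * (phase μ p.1 * phase ν p.2)) (μ.variation.prod ν.variation) :=
  hk.mul_bdd (c := 1) (Measurable.aestronglyMeasurable (by fun_prop))
    (ae_of_all _ fun p => by simp)

variable [MeasurableAdd₂ G]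

/-- The convolution of two complex measures, weighted with a function of two variables. -/
noncomputable def wconv (w : G → G → ℂ) (μ ν : ComplexMeasure G) : ComplexMeasure G :=
  ((μ.variation.prod ν.variation).withDensityᵥ
    fun p => w p.1 p.2 * (phase μ p.1 * phase ν p.2)).map fun p => p.1 + p.2

/-- Fubini for `|μ| × |ν|` combined with a change of variables along addition. Boundedness of `φ`
lets integrability of `w` alone suffice. -/
theorem cintegral_wconv (hw : Measurable (Function.uncurry w))
    (hwi : Integrable (Function.uncurry w) (μ.variation.prod ν.variation))
    {φ : G → ℂ} (hφ : Measurable φ) {C : ℝ} (hC : ∀ x, ‖φ x‖ ≤ C) :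
    cintegral (wconv w μ ν) φ =
      cintegral μ fun f => cintegral ν fun g => w f g * φ (f + g) := by
  have hk : Integrable (Function.uncurry fun f g => w f g * φ (f + g))
      (μ.variation.prod ν.variation) :=
    hwi.mul_bdd (c := C) (hφ.comp measurable_add).aestronglyMeasurable
      (ae_of_all _ fun p => hC _)
  have hm : Measurable fun p : G × G => w p.1 p.2 := hw
  have hwi' : Integrable (fun p : G × G => w p.1 p.2) (μ.variation.prod ν.variation) := hwi
  rw [cintegral_cintegral hk, wconv, cintegral_map measurable_add _ hφ hC,
    cintegral_withDensityᵥ (by fun_prop) (integrable_mul_phase_mul_phase hwi')]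
  · congr 1
    ext p
    ring
  · refine (integrable_mul_phase_mul_phase hk).congr (ae_of_all _ fun p => ?_)
    simp only [Function.uncurry]
    ring

theorem wconv_apply (hw : Measurable (Function.uncurry w))
    (hwi : Integrable (Function.uncurry w) (μ.variation.prod ν.variation))
    {s : Set G} (hs : MeasurableSet s) :
    wconv w μ ν s =
      cintegral μ fun f => cintegral ν fun g => w f g * s.indicator (fun _ => 1) (f + g) := by
  rw [← cintegral_indicator_one _ hs, cintegral_wconv hw hwi
    (measurable_const.indicator hs) (C := 1) fun x => ?_]
  exact (norm_indicator_le_norm_self _ _).trans (by simp)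

theorem variation_wconv_le
    (hwi : Integrable (Function.uncurry w) (μ.variation.prod ν.variation)) :
    (wconv w μ ν).variation Set.univ ≤
      ∫⁻ p, ‖w p.1 p.2‖ₑ ∂μ.variation.prod ν.variation := by
  have hwi' : Integrable (fun p : G × G => w p.1 p.2) (μ.variation.prod ν.variation) := hwi
  refine (VectorMeasure.variation_map_le Set.univ).trans ?_
  rw [Measure.map_apply measurable_add MeasurableSet.univ, Set.preimage_univ,
    Measure.variation_withDensityᵥ (integrable_mul_phase_mul_phase hwi'),
    withDensity_apply _ MeasurableSet.univ, Measure.restrict_univ]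
  refine lintegral_mono fun p => ?_
  simp [← ofReal_norm]

theorem integrable_uncurry_of_bound {X Y : Type*} [MeasurableSpace X] [MeasurableSpace Y]
    {w : X → Y → ℂ} (hw : Measurable (Function.uncurry w)) {C : ℝ}
    (hC : ∀ f g, ‖w f g‖ ≤ C) (m : Measure (X × Y)) [IsFiniteMeasure m] :
    Integrable (Function.uncurry w) m :=
  Integrable.of_bound hw.aestronglyMeasurable C (ae_of_all _ fun p => hC p.1 p.2)

theorem measurable_cintegral_mul_indicator (hw : Measurable (Function.uncurry w))
    (ν : ComplexMeasure G) {s : Set G} (hs : MeasurableSet s) :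
    Measurable fun f => cintegral ν fun g => w f g * s.indicator (fun _ => 1) (f + g) := by
  have hwm : Measurable fun p : G × G => w p.1 p.2 := hw
  exact measurable_cintegral_right _ (hwm.mul ((measurable_const.indicator hs).comp measurable_add))

theorem integrable_cintegral_mul_indicator (hw : Measurable (Function.uncurry w)) {C : ℝ}
    (hC : ∀ f g, ‖w f g‖ ≤ C) (ν : ComplexMeasure G) {s : Set G} (hs : MeasurableSet s)
    (m : Measure G) [IsFiniteMeasure m] :
    Integrable (fun f => cintegral ν fun g => w f g * s.indicator (fun _ => 1) (f + g)) m :=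
  Integrable.of_bound (measurable_cintegral_mul_indicator hw ν hs).aestronglyMeasurable _
    (ae_of_all _ fun f => norm_cintegral_mul_indicator_le hC ν s f)

theorem wconv_add_left (hw : Measurable (Function.uncurry w)) {C : ℝ}
    (hC : ∀ f g, ‖w f g‖ ≤ C) (μ μ' ν : ComplexMeasure G) :
    wconv w (μ + μ') ν = wconv w μ ν + wconv w μ' ν := by
  ext s hs
  rw [add_apply, wconv_apply hw (integrable_uncurry_of_bound hw hC _) hs,
    wconv_apply hw (integrable_uncurry_of_bound hw hC _) hs,
    wconv_apply hw (integrable_uncurry_of_bound hw hC _) hs, cintegral_add_measure]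
  all_goals exact integrable_cintegral_mul_indicator hw hC ν hs _

theorem wconv_smul_left (hw : Measurable (Function.uncurry w)) {C : ℝ}
    (hC : ∀ f g, ‖w f g‖ ≤ C) (c : ℂ) (μ ν : ComplexMeasure G) :
    wconv w (c • μ) ν = c • wconv w μ ν := by
  ext s hs
  rw [smul_apply, wconv_apply hw (integrable_uncurry_of_bound hw hC _) hs,
    wconv_apply hw (integrable_uncurry_of_bound hw hC _) hs, cintegral_smul_measure, smul_eq_mul]
  exact integrable_cintegral_mul_indicator hw hC ν hs _

/-- Convolution weighted with a bounded cocycle is associative. -/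
theorem wconv_assoc (hw : Measurable (Function.uncurry w)) {C : ℝ} (hC : ∀ f g, ‖w f g‖ ≤ C)
    (hcoc : ∀ f g h, w f g * w (f + g) h = w g h * w f (g + h)) :
    wconv w (wconv w μ ν) κ = wconv w μ (wconv w ν κ) := by
  have hwm : Measurable fun p : G × G => w p.1 p.2 := hw
  ext s hs
  have hsm : Measurable (s.indicator fun _ => (1 : ℂ)) := measurable_const.indicator hs
  rw [wconv_apply hw (integrable_uncurry_of_bound hw hC _) hs,
    wconv_apply hw (integrable_uncurry_of_bound hw hC _) hs]
  rw [cintegral_wconv hw (integrable_uncurry_of_bound hw hC _)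
    (φ := fun h => cintegral κ fun k => w h k * s.indicator (fun _ => 1) (h + k))
    (C := C * κ.variation.real Set.univ)]
  · congr 1
    ext f
    rw [cintegral_wconv hw (integrable_uncurry_of_bound hw hC _)
      (φ := fun h => w f h * s.indicator (fun _ => 1) (f + h)) (C := C)]
    · congr 1
      ext g
      rw [← cintegral_const_mul]
      congr 1
      ext h
      -- Both sides are now iterated integrals over `f`, `g`, `h` in the same order; the cocycle
      -- identity matches the integrands.
      rw [← mul_assoc, ← mul_assoc, hcoc, add_assoc]
    · exact (hwm.comp measurable_prodMk_left).mul (hsm.comp (measurable_const_add f))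
    · intro x
      rw [norm_mul]
      exact (mul_le_of_le_one_right (norm_nonneg _) (norm_indicator_one_le s _)).trans (hC f x)
  · exact measurable_cintegral_mul_indicator hw κ hs
  · exact norm_cintegral_mul_indicator_le hC κ s

end GroupConvolution

/-! ### Reduction to subspaces of countable dimension. -/

section SigmaFinDim

variable {E : Type u} [AddCommGroup E] [Module ℝ E]

/-- The linear subspace `S` is the union of an increasing sequence of finite dimensional
subspaces. -/
def IsSigmaFinDim (S : Submodule ℝ E) : Prop :=
  ∃ V : ℕ → Submodule ℝ E, Monotone V ∧ (∀ n, FiniteDimensional ℝ (V n)) ∧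
    (S : Set E) = ⋃ n, (V n : Set E)

theorem isSigmaFinDim_iSup {V : ℕ → Submodule ℝ E} (hV : Monotone V)
    (hfd : ∀ n, FiniteDimensional ℝ (V n)) : IsSigmaFinDim (⨆ n, V n) :=
  ⟨V, hV, hfd, Submodule.coe_iSup_of_directed V hV.directed_le⟩

theorem IsSigmaFinDim.sup {S T : Submodule ℝ E} (hS : IsSigmaFinDim S) (hT : IsSigmaFinDim T) :
    IsSigmaFinDim (S ⊔ T) := by
  obtain ⟨V, hV, hVf, hVS⟩ := hS
  obtain ⟨W, hW, hWf, hWT⟩ := hT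
  have h1 : S = ⨆ n, V n := SetLike.coe_injective
    (hVS.trans (Submodule.coe_iSup_of_directed V hV.directed_le).symm)
  have h2 : T = ⨆ n, W n := SetLike.coe_injective
    (hWT.trans (Submodule.coe_iSup_of_directed W hW.directed_le).symm)
  rw [h1, h2, ← iSup_sup_eq]
  exact isSigmaFinDim_iSup (fun m n h => sup_le_sup (hV h) (hW h)) fun n => inferInstance

section

variable [MeasurableSpace E]

theorem ConcentratedOn.variation_compl {S : Submodule ℝ E} (hS : MeasurableSet (S : Set E))
    {μ : ComplexMeasure E} (h : ConcentratedOn S μ) : μ.variation (S : Set E)ᶜ = 0 := by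
  rw [VectorMeasure.variation_apply_eq_zero hS.compl]
  intro t ht htS
  rw [← h t htS, Set.disjoint_iff_inter_eq_empty.1 (Set.disjoint_left.2 fun x hx => ht hx)]
  simp

theorem concentratedOn_of_variation_compl {S : Submodule ℝ E} (hS : MeasurableSet (S : Set E))
    {μ : ComplexMeasure E} (h : μ.variation (S : Set E)ᶜ = 0) : ConcentratedOn S μ := by
  intro s hs
  rw [VectorMeasure.variation_apply_eq_zero hS.compl] at h
  have h2 := h (s \ S) (fun x hx => hx.2) (hs.diff hS)
  have h3 := VectorMeasure.of_add_of_sdiff (v := μ) (hs.inter hS) hs Set.inter_subset_left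
  rw [Set.sdiff_self_inter, h2, add_zero] at h3
  exact h3

end

variable [TopologicalSpace E] [IsTopologicalAddGroup E] [ContinuousSMul ℝ E] [T2Space E]

theorem secondCountableTopology_of_finiteDimensional (V : Submodule ℝ E)
    [FiniteDimensional ℝ V] : SecondCountableTopology V :=
  (ContinuousLinearEquiv.ofFinrankEq (𝕜 := ℝ) (E := V)
    (F := EuclideanSpace ℝ (Fin (Module.finrank ℝ V))) (by simp)).toHomeomorph.secondCountableTopology

variable [MeasurableSpace E] [BorelSpace E]

theorem IsSigmaFinDim.measurableSet {S : Submodule ℝ E} (hS : IsSigmaFinDim S) :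
    MeasurableSet (S : Set E) := by
  obtain ⟨V, -, hVf, hVS⟩ := hS
  rw [hVS]
  exact MeasurableSet.iUnion fun n => measurableSet_finiteDimensional E (V n)

/-- Functions on `E × E` whose restrictions to `V × V` are Borel measurable for all finite
dimensional subspaces `V`. -/
def FinDimMeasurable {Z : Type*} [MeasurableSpace Z] (k : E → E → Z) : Prop :=
  ∀ V : Submodule ℝ E, FiniteDimensional ℝ V → Measurable fun p : V × V => k p.1 p.2

/-- A finite dimensional subspace is second countable, so the Borel σ-algebra of `V × V` is the
product σ-algebra. On `E × E` this may fail. -/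
theorem finDimMeasurable_of_continuous {Z : Type*} [MeasurableSpace Z] [TopologicalSpace Z]
    [BorelSpace Z] {k : E → E → Z}
    (hk : ∀ V : Submodule ℝ E, FiniteDimensional ℝ V → Continuous fun p : V × V => k p.1 p.2) :
    FinDimMeasurable k := by
  intro V hV
  have := secondCountableTopology_of_finiteDimensional V
  exact (hk V hV).measurable

theorem finDimMeasurable_add : FinDimMeasurable fun f g : E => f + g :=
  finDimMeasurable_of_continuous fun V _ => by fun_prop

/-- Expanding the first argument in a basis of `V` writes the form as a finite sum of products of
linear functionals, which are automatically continuous on `V`. -/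
theorem finDimMeasurable_bilinForm (σ : LinearMap.BilinForm ℝ E) :
    FinDimMeasurable fun f g : E => σ f g := by
  refine finDimMeasurable_of_continuous fun V _ => ?_
  let b := Module.finBasis ℝ V
  have h : (fun p : V × V => σ p.1 p.2) =
      fun p => ∑ i, b.coord i p.1 * (σ (b i : E)).comp V.subtype p.2 := by
    ext p
    have h1 : (p.1 : E) = ∑ i, b.repr p.1 i • (b i : E) := by
      conv_lhs => rw [← b.sum_repr p.1]
      simp only [Submodule.coe_sum, Submodule.coe_smul]
    rw [h1]
    simp only [map_sum, LinearMap.sum_apply, map_smul, LinearMap.smul_apply, smul_eq_mul]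
    rfl
  rw [h]
  refine continuous_finsetSum _ fun i _ => ?_
  exact ((b.coord i).continuous_of_finiteDimensional.comp continuous_fst).mul
    (((σ (b i : E)).comp V.subtype).continuous_of_finiteDimensional.comp continuous_snd)

/-- A function of two variables which is measurable on all finite dimensional subspaces is
measurable on subspaces of countable dimension. -/
theorem IsSigmaFinDim.measurable_restrict {S : Submodule ℝ E} (hS : IsSigmaFinDim S) {Z : Type*}
    [MeasurableSpace Z] {k : E → E → Z} (hk : FinDimMeasurable k) :
    Measurable fun p : S × S => k p.1 p.2 := by
  obtain ⟨V, hV, hVf, hVS⟩ := hS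
  have hle : ∀ n, V n ≤ S := fun n x hx => by
    have : x ∈ (S : Set E) := hVS ▸ Set.mem_iUnion.2 ⟨n, hx⟩
    exact this
  have hemb : ∀ n, MeasurableEmbedding (Submodule.inclusion (hle n)) := fun n =>
    { injective := Submodule.inclusion_injective _
      measurable := (continuous_subtype_val.subtype_mk _).measurable
      measurableSet_image' := by
        intro t ht
        have h1 : MeasurableSet (Subtype.val '' t : Set E) :=
          (MeasurableEmbedding.subtype_coe
            (measurableSet_finiteDimensional E (V n))).measurableSet_image.2 ht
        convert measurable_subtype_coe (p := (· ∈ S)) h1 using 1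
        ext x
        constructor
        · rintro ⟨y, hy, rfl⟩
          exact ⟨y, hy, rfl⟩
        · rintro ⟨y, hy, hyx⟩
          exact ⟨y, hy, Subtype.ext hyx⟩ }
  intro t ht
  -- Monotonicity puts each pair in `S × S` into a common `V n × V n`, so the preimage is a
  -- countable union of images under measurable embeddings.
  have key : (fun p : S × S => k p.1 p.2) ⁻¹' t =
      ⋃ n, Prod.map (Submodule.inclusion (hle n)) (Submodule.inclusion (hle n)) ''
        ((fun p : V n × V n => k p.1 p.2) ⁻¹' t) := by
    ext ⟨x, y⟩
    simp only [Set.mem_preimage, Set.mem_iUnion, Set.mem_image, Prod.exists, Prod.map_apply,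
      Prod.mk.injEq]
    constructor
    · intro h
      obtain ⟨m, hm⟩ := Set.mem_iUnion.1 (hVS ▸ x.2 : (x : E) ∈ ⋃ n, (V n : Set E))
      obtain ⟨n, hn⟩ := Set.mem_iUnion.1 (hVS ▸ y.2 : (y : E) ∈ ⋃ n, (V n : Set E))
      exact ⟨max m n, ⟨x, hV (le_max_left m n) hm⟩, ⟨y, hV (le_max_right m n) hn⟩, h, rfl, rfl⟩
    · rintro ⟨n, a, b, h, rfl, rfl⟩
      exact h
  rw [key]
  exact MeasurableSet.iUnion fun n =>
    ((hemb n).prodMap (hemb n)).measurableSet_image.2 (hk (V n) (hVf n) ht)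

theorem IsSigmaFinDim.measurableAdd₂ {S : Submodule ℝ E} (hS : IsSigmaFinDim S) :
    MeasurableAdd₂ S :=
  ⟨(hS.measurable_restrict finDimMeasurable_add).subtype_mk⟩

theorem IsSigmaFinDim.measurableEmbedding {S : Submodule ℝ E} (hS : IsSigmaFinDim S) :
    MeasurableEmbedding (Subtype.val : S → E) :=
  MeasurableEmbedding.subtype_coe hS.measurableSet

/-- An approximating `ν` concentrated on `V` has no mass outside `V`, so there `|μ|` is bounded by
`|μ - ν|`. -/
theorem exists_variation_compl_le {μ : ComplexMeasure E} (hμ : μ ∈ regMeasures E) {ε : ℝ≥0∞}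
    (hε : ε ≠ 0) : ∃ V : Submodule ℝ E, FiniteDimensional ℝ V ∧ μ.variation (V : Set E)ᶜ ≤ ε := by
  obtain ⟨V, hV, ν, hν, hd⟩ := hμ ε hε
  have hVm := measurableSet_finiteDimensional E V
  refine ⟨V, hV, le_trans ?_ hd⟩
  have e : μ = (μ - ν) + ν := by abel
  calc μ.variation (V : Set E)ᶜ ≤ ((μ - ν).variation + ν.variation) (V : Set E)ᶜ := by
        conv_lhs => rw [e]
        exact VectorMeasure.variation_add_le _
    _ = (μ - ν).variation (V : Set E)ᶜ := by
        rw [Measure.add_apply, hν.variation_compl hVm, add_zero]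
    _ ≤ _ := measure_mono (Set.subset_univ _)

/-- Choose finite dimensional subspaces missing mass at most `1/(n+1)`; the union of their
successive suprema carries all of `μ`. -/
theorem exists_concentratedOn {μ : ComplexMeasure E} (hμ : μ ∈ regMeasures E) :
    ∃ S : Submodule ℝ E, IsSigmaFinDim S ∧ ConcentratedOn S μ := by
  have h : ∀ n : ℕ, ∃ V : Submodule ℝ E, FiniteDimensional ℝ V ∧
      μ.variation (V : Set E)ᶜ ≤ ((n : ℝ≥0∞) + 1)⁻¹ := fun n =>
    exists_variation_compl_le hμ (by simp)
  choose V hVf hV using h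
  let W : ℕ → Submodule ℝ E := fun n => (Finset.range (n + 1)).sup V
  have hWf : ∀ n, FiniteDimensional ℝ (W n) := fun n =>
    Submodule.finiteDimensional_finset_sup _ _
  have hW : Monotone W := fun m n hmn => Finset.sup_mono (Finset.range_mono (by omega))
  have hSW := isSigmaFinDim_iSup hW hWf
  refine ⟨⨆ n, W n, hSW, concentratedOn_of_variation_compl hSW.measurableSet ?_⟩
  have hle : ∀ n, V n ≤ ⨆ n, W n := fun n =>
    (Finset.le_sup (f := V) (Finset.self_mem_range_succ n)).trans (le_iSup W n)
  refine le_antisymm (ge_of_tendsto' (f := fun n : ℕ => ((n : ℝ≥0∞) + 1)⁻¹) (x := atTop) ?_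
    fun n => (measure_mono (Set.compl_subset_compl.2 (hle n))).trans (hV n)) zero_le
  exact_mod_cast (tendsto_add_atTop_iff_nat 1).2 ENNReal.tendsto_inv_nat_nhds_zero

/-- Conversely, the complements of the `V n` decrease to a null set, so the restrictions of `μ` to
the `V n` approximate `μ` in variation. -/
theorem ConcentratedOn.mem_regMeasures {S : Submodule ℝ E} (hS : IsSigmaFinDim S)
    {μ : ComplexMeasure E} (h : ConcentratedOn S μ) : μ ∈ regMeasures E := by
  have h0 := h.variation_compl hS.measurableSet
  obtain ⟨V, hV, hVf, hVS⟩ := hS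
  have hVm : ∀ n, MeasurableSet (V n : Set E) := fun n => measurableSet_finiteDimensional E (V n)
  have hlim : Tendsto (fun n => μ.variation (V n : Set E)ᶜ) atTop (𝓝 0) := by
    rw [← h0, hVS, Set.compl_iUnion]
    exact tendsto_measure_iInter_atTop (fun n => (hVm n).compl.nullMeasurableSet)
      (fun m n hmn => Set.compl_subset_compl.2 (hV hmn)) ⟨0, measure_ne_top _ _⟩
  intro ε hε
  obtain ⟨n, hn⟩ := (hlim.eventually (gt_mem_nhds (pos_iff_ne_zero.2 hε))).exists
  refine ⟨V n, hVf n, μ.restrict (V n), ?_, ?_⟩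
  · intro s hs
    rw [VectorMeasure.restrict_apply _ (hVm n) (hs.inter (hVm n)),
      VectorMeasure.restrict_apply _ (hVm n) hs, Set.inter_assoc, Set.inter_self]
  · have e : μ - μ.restrict (V n) = μ.restrict (V n : Set E)ᶜ := by
      rw [sub_eq_iff_eq_add, add_comm, VectorMeasure.restrict_add_restrict_compl (hVm n)]
    rw [e, VectorMeasure.variation_restrict (hVm n).compl, Measure.restrict_apply_univ]
    exact hn.le

/-- A complex measure concentrated on a measurable subspace comes from that subspace. -/
theorem ConcentratedOn.exists_map_eq {S : Submodule ℝ E} (hS : IsSigmaFinDim S)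
    {μ : ComplexMeasure E} (h : ConcentratedOn S μ) :
    ∃ μ' : ComplexMeasure S, μ'.map Subtype.val = μ := by
  have hj := hS.measurableEmbedding
  classical
  let r : E → S := fun x => if hx : x ∈ S then ⟨x, hx⟩ else 0
  have hr : Measurable r := by
    refine Measurable.dite (s := (S : Set E)) measurable_id measurable_const hS.measurableSet
  refine ⟨μ.map r, ?_⟩
  ext s hs
  rw [VectorMeasure.map_apply _ hj.measurable hs, VectorMeasure.map_apply _ hr
    (hj.measurable hs), ← h s hs, ← h _ (hr (hj.measurable hs))]
  congr 1
  ext x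
  simp only [Set.mem_inter_iff, Set.mem_preimage, SetLike.mem_coe]
  refine and_congr_left fun hx => ?_
  simp [r, hx]

theorem concentratedOn_map {S : Submodule ℝ E} (hS : IsSigmaFinDim S) (μ : ComplexMeasure S) :
    ConcentratedOn S (μ.map Subtype.val) := by
  have hj := hS.measurableEmbedding
  intro s hs
  rw [VectorMeasure.map_apply _ hj.measurable hs,
    VectorMeasure.map_apply _ hj.measurable (hs.inter hS.measurableSet)]
  congr 1
  ext x
  simp

theorem map_mem_regMeasures {S : Submodule ℝ E} (hS : IsSigmaFinDim S) (μ : ComplexMeasure S) :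
    μ.map Subtype.val ∈ regMeasures E :=
  (concentratedOn_map hS μ).mem_regMeasures hS

/-- The measure in `𝓜(E)` obtained from a measure on a subspace of countable dimension. -/
noncomputable def ofSubspace {S : Submodule ℝ E} (hS : IsSigmaFinDim S) (μ : ComplexMeasure S) :
    regMeasures E :=
  ⟨μ.map Subtype.val, map_mem_regMeasures hS μ⟩

/-- Allowing every larger subspace `T` is what lets several measures be placed on one common
subspace. -/
theorem exists_ofSubspace (μ : regMeasures E) : ∃ S : Submodule ℝ E, IsSigmaFinDim S ∧
    ∀ T : Submodule ℝ E, S ≤ T → ∀ hT : IsSigmaFinDim T,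
      ∃ μ' : ComplexMeasure T, ofSubspace hT μ' = μ := by
  obtain ⟨S, hS, hμ⟩ := exists_concentratedOn μ.2
  refine ⟨S, hS, fun T hST hT => ?_⟩
  obtain ⟨μ', h⟩ := (hμ.mono hT.measurableSet hST).exists_map_eq hT
  exact ⟨μ', Subtype.ext h⟩

theorem exists_ofSubspace₂ (μ ν : regMeasures E) : ∃ (S : Submodule ℝ E) (hS : IsSigmaFinDim S)
    (μ' ν' : ComplexMeasure S), ofSubspace hS μ' = μ ∧ ofSubspace hS ν' = ν := by
  obtain ⟨S, hS, h⟩ := exists_ofSubspace μ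
  obtain ⟨T, hT, h'⟩ := exists_ofSubspace ν
  obtain ⟨μ', hμ'⟩ := h (S ⊔ T) le_sup_left (hS.sup hT)
  obtain ⟨ν', hν'⟩ := h' (S ⊔ T) le_sup_right (hS.sup hT)
  exact ⟨S ⊔ T, hS.sup hT, μ', ν', hμ', hν'⟩

theorem exists_ofSubspace₃ (μ ν κ : regMeasures E) : ∃ (S : Submodule ℝ E)
    (hS : IsSigmaFinDim S) (μ' ν' κ' : ComplexMeasure S),
    ofSubspace hS μ' = μ ∧ ofSubspace hS ν' = ν ∧ ofSubspace hS κ' = κ := by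
  obtain ⟨S, hS, h⟩ := exists_ofSubspace μ
  obtain ⟨T, hT, h'⟩ := exists_ofSubspace ν
  obtain ⟨R, hR, h''⟩ := exists_ofSubspace κ
  have hSTR := (hS.sup hT).sup hR
  obtain ⟨μ', hμ'⟩ := h (S ⊔ T ⊔ R) (le_sup_left.trans le_sup_left) hSTR
  obtain ⟨ν', hν'⟩ := h' (S ⊔ T ⊔ R) (le_sup_right.trans le_sup_left) hSTR
  obtain ⟨κ', hκ'⟩ := h'' (S ⊔ T ⊔ R) le_sup_right hSTR
  exact ⟨_, hSTR, μ', ν', κ', hμ', hν', hκ'⟩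

end SigmaFinDim

section

variable {E : Type u} [AddCommGroup E] [Module ℝ E] [MeasurableSpace E]

theorem FinDimMeasurable.comp {Z Z' : Type*} [MeasurableSpace Z] [MeasurableSpace Z']
    {k : E → E → Z} (hk : FinDimMeasurable k) {φ : Z → Z'} (hφ : Measurable φ) :
    FinDimMeasurable fun f g => φ (k f g) :=
  fun V hV => hφ.comp (hk V hV)

theorem FinDimMeasurable.sub {k l : E → E → ℂ} (hk : FinDimMeasurable k)
    (hl : FinDimMeasurable l) : FinDimMeasurable fun f g => k f g - l f g :=
  fun V hV => (hk V hV).sub (hl V hV)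

theorem FinDimMeasurable.swap {Z : Type*} [MeasurableSpace Z] {k : E → E → Z}
    (hk : FinDimMeasurable k) : FinDimMeasurable fun f g => k g f :=
  fun V hV => (hk V hV).comp measurable_swap

end

/-! ### Weighted convolution on `𝓜(E)`, transported from subspaces. -/

section WeightedConvolution

variable {E : Type u} [AddCommGroup E] [Module ℝ E] [TopologicalSpace E]
  [IsTopologicalAddGroup E] [ContinuousSMul ℝ E] [T2Space E] [MeasurableSpace E] [BorelSpace E]

/-- The product of the total variation measures. -/
noncomputable def prodVariation (μ ν : regMeasures E) : Measure (E × E) :=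
  (μ : ComplexMeasure E).variation.prod (ν : ComplexMeasure E).variation

instance (μ ν : regMeasures E) : IsFiniteMeasure (prodVariation μ ν) := by
  unfold prodVariation; infer_instance

theorem prodVariation_ofSubspace {S : Submodule ℝ E} (hS : IsSigmaFinDim S)
    (μ ν : ComplexMeasure S) : prodVariation (ofSubspace hS μ) (ofSubspace hS ν) =
      (μ.variation.prod ν.variation).map (Prod.map Subtype.val Subtype.val) := by
  have hj := hS.measurableEmbedding
  rw [prodVariation, ofSubspace, ofSubspace, hj.variation_map, hj.variation_map,
    Measure.map_prod_map _ _ hj.measurable hj.measurable]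

/-- `S × S` carries the product of the variations, so behaviour of `k` off it is irrelevant; only
almost everywhere measurability can be claimed. -/
theorem FinDimMeasurable.aemeasurable {Z : Type*} [MeasurableSpace Z] {k : E → E → Z}
    (hk : FinDimMeasurable k) (μ ν : regMeasures E) :
    AEMeasurable (Function.uncurry k) (prodVariation μ ν) := by
  obtain ⟨S, hS, μ', ν', rfl, rfl⟩ := exists_ofSubspace₂ μ ν
  have hj := hS.measurableEmbedding
  rw [prodVariation_ofSubspace, (hj.prodMap hj).aemeasurable_map_iff]
  exact (hS.measurable_restrict hk).aemeasurable

theorem FinDimMeasurable.aestronglyMeasurable {k : E → E → ℂ}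
    (hk : FinDimMeasurable k) (μ ν : regMeasures E) :
    AEStronglyMeasurable (Function.uncurry k) (prodVariation μ ν) :=
  (hk.aemeasurable μ ν).aestronglyMeasurable

theorem FinDimMeasurable.integrable_of_bound {k : E → E → ℂ}
    (hk : FinDimMeasurable k) {C : ℝ} (hC : ∀ f g, ‖k f g‖ ≤ C) (μ ν : regMeasures E) :
    Integrable (Function.uncurry k) (prodVariation μ ν) :=
  Integrable.of_bound (hk.aestronglyMeasurable μ ν) C (ae_of_all _ fun p => hC p.1 p.2)

theorem integrable_mul_comp_add {w : E → E → ℂ} {μ ν : regMeasures E}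
    (hwi : Integrable (Function.uncurry w) (prodVariation μ ν)) {φ : E → ℂ} (hφ : Measurable φ)
    {C : ℝ} (hC : ∀ x, ‖φ x‖ ≤ C) :
    Integrable (Function.uncurry fun f g => w f g * φ (f + g)) (prodVariation μ ν) :=
  hwi.mul_bdd (c := C) ((finDimMeasurable_add.comp hφ).aestronglyMeasurable μ ν)
    (ae_of_all _ fun _ => hC _)

theorem integrable_restrict {S : Submodule ℝ E} (hS : IsSigmaFinDim S) {w : E → E → ℂ}
    {μ ν : ComplexMeasure S} (hwi : Integrable (Function.uncurry w)
      (prodVariation (ofSubspace hS μ) (ofSubspace hS ν))) :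
    Integrable (Function.uncurry fun a b : S => w a b) (μ.variation.prod ν.variation) := by
  have hj := hS.measurableEmbedding
  rw [prodVariation_ofSubspace, (hj.prodMap hj).integrable_map_iff] at hwi
  exact hwi

theorem cintegral_ofSubspace {S : Submodule ℝ E} (hS : IsSigmaFinDim S) (μ : ComplexMeasure S)
    (φ : E → ℂ) :
    cintegral (ofSubspace hS μ : ComplexMeasure E) φ = cintegral μ fun x => φ x :=
  cintegral_map_of_embedding hS.measurableEmbedding μ φ

theorem cintegral_ofSubspace_wconv {S : Submodule ℝ E} (hS : IsSigmaFinDim S)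
    [MeasurableAdd₂ S] {w : E → E → ℂ} (hw : FinDimMeasurable w) {μ ν : ComplexMeasure S}
    (hwi : Integrable (Function.uncurry w)
      (prodVariation (ofSubspace hS μ) (ofSubspace hS ν)))
    {φ : E → ℂ} (hφ : Measurable φ) {C : ℝ} (hC : ∀ x, ‖φ x‖ ≤ C) :
    cintegral (ofSubspace hS (wconv (fun a b : S => w a b) μ ν) : ComplexMeasure E) φ =
      cintegral (ofSubspace hS μ : ComplexMeasure E) fun f =>
        cintegral (ofSubspace hS ν : ComplexMeasure E) fun g => w f g * φ (f + g) := by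
  simp only [cintegral_ofSubspace]
  rw [cintegral_wconv (hS.measurable_restrict hw) (integrable_restrict hS hwi)
    (φ := fun x : S => φ x) (hφ.comp measurable_subtype_coe) (fun x => hC x)]
  rfl

theorem isWeightedConv_ofSubspace {S : Submodule ℝ E} (hS : IsSigmaFinDim S)
    [MeasurableAdd₂ S] {w : E → E → ℂ} (hw : FinDimMeasurable w) {μ ν : ComplexMeasure S}
    (hwi : Integrable (Function.uncurry w)
      (prodVariation (ofSubspace hS μ) (ofSubspace hS ν))) :
    IsWeightedConv w (ofSubspace hS μ) (ofSubspace hS ν)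
      (ofSubspace hS (wconv (fun a b : S => w a b) μ ν)) := by
  intro s hs
  rw [← cintegral_indicator_one _ hs, cintegral_ofSubspace_wconv hS hw hwi
    (measurable_const.indicator hs) (norm_indicator_one_le s)]

theorem IsWeightedConv.unique {w : E → E → ℂ} {μ ν ρ ρ' : regMeasures E}
    (h : IsWeightedConv w μ ν ρ) (h' : IsWeightedConv w μ ν ρ') : ρ = ρ' :=
  Subtype.ext (VectorMeasure.ext fun s hs => (h s hs).trans (h' s hs).symm)

/-- Existence, proved on a common subspace, rules out the default value `0` of `weightedConv`. -/
theorem isWeightedConv_weightedConv {w : E → E → ℂ} (hw : FinDimMeasurable w)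
    {μ ν : regMeasures E} (hwi : Integrable (Function.uncurry w) (prodVariation μ ν)) :
    IsWeightedConv w μ ν (weightedConv w μ ν) := by
  have h : ∃ ρ : regMeasures E, IsWeightedConv w μ ν ρ := by
    obtain ⟨S, hS, μ', ν', rfl, rfl⟩ := exists_ofSubspace₂ μ ν
    have := hS.measurableAdd₂
    exact ⟨_, isWeightedConv_ofSubspace hS hw hwi⟩
  rw [weightedConv, dif_pos h]
  exact h.choose_spec

theorem weightedConv_ofSubspace {S : Submodule ℝ E} (hS : IsSigmaFinDim S)
    [MeasurableAdd₂ S] {w : E → E → ℂ} (hw : FinDimMeasurable w) {μ ν : ComplexMeasure S}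
    (hwi : Integrable (Function.uncurry w)
      (prodVariation (ofSubspace hS μ) (ofSubspace hS ν))) :
    weightedConv w (ofSubspace hS μ) (ofSubspace hS ν) =
      ofSubspace hS (wconv (fun a b : S => w a b) μ ν) :=
  (isWeightedConv_weightedConv hw hwi).unique (isWeightedConv_ofSubspace hS hw hwi)

theorem cintegral_weightedConv {w : E → E → ℂ} (hw : FinDimMeasurable w)
    {μ ν : regMeasures E} (hwi : Integrable (Function.uncurry w) (prodVariation μ ν))
    {φ : E → ℂ} (hφ : Measurable φ) {C : ℝ} (hC : ∀ x, ‖φ x‖ ≤ C) :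
    cintegral (weightedConv w μ ν : ComplexMeasure E) φ =
      cintegral (μ : ComplexMeasure E) fun f =>
        cintegral (ν : ComplexMeasure E) fun g => w f g * φ (f + g) := by
  obtain ⟨S, hS, μ', ν', rfl, rfl⟩ := exists_ofSubspace₂ μ ν
  have := hS.measurableAdd₂
  rw [weightedConv_ofSubspace hS hw hwi, cintegral_ofSubspace_wconv hS hw hwi hφ hC]

theorem variation_weightedConv_le {w : E → E → ℂ} (hw : FinDimMeasurable w)
    {μ ν : regMeasures E} (hwi : Integrable (Function.uncurry w) (prodVariation μ ν)) :
    (weightedConv w μ ν : ComplexMeasure E).variation Set.univ ≤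
      ∫⁻ p, ‖w p.1 p.2‖ₑ ∂prodVariation μ ν := by
  obtain ⟨S, hS, μ', ν', rfl, rfl⟩ := exists_ofSubspace₂ μ ν
  have := hS.measurableAdd₂
  have hj := hS.measurableEmbedding
  rw [weightedConv_ofSubspace hS hw hwi, prodVariation_ofSubspace,
    (hj.prodMap hj).lintegral_map, ofSubspace, hj.variation_map, hj.map_apply, Set.preimage_univ]
  exact variation_wconv_le (integrable_restrict hS hwi)

theorem tvNorm_weightedConv_le {w : E → E → ℂ} (hw : FinDimMeasurable w)
    {μ ν : regMeasures E} (hwi : Integrable (Function.uncurry w) (prodVariation μ ν)) :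
    tvNorm (weightedConv w μ ν) ≤ ∫ p, ‖w p.1 p.2‖ ∂prodVariation μ ν := by
  rw [integral_norm_eq_lintegral_enorm (f := fun p : E × E => w p.1 p.2) hwi.1]
  exact ENNReal.toReal_mono hwi.2.ne (variation_weightedConv_le hw hwi)

/-- A single integral over the product, linear in `w` and symmetric under exchange of the two
factors; the algebraic rules in the weight follow from this form. -/
theorem weightedConv_apply {w : E → E → ℂ} (hw : FinDimMeasurable w)
    {μ ν : regMeasures E} (hwi : Integrable (Function.uncurry w) (prodVariation μ ν))
    {s : Set E} (hs : MeasurableSet s) :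
    (weightedConv w μ ν : ComplexMeasure E) s =
      ∫ p, w p.1 p.2 * s.indicator (fun _ => 1) (p.1 + p.2) *
        (phase (μ : ComplexMeasure E) p.1 * phase (ν : ComplexMeasure E) p.2)
        ∂prodVariation μ ν := by
  rw [isWeightedConv_weightedConv hw hwi s hs, cintegral_cintegral]
  · rfl
  · exact integrable_mul_comp_add hwi (measurable_const.indicator hs) (norm_indicator_one_le s)

theorem weightedConv_sub {w w' : E → E → ℂ} (hw : FinDimMeasurable w)
    (hw' : FinDimMeasurable w') {μ ν : regMeasures E}
    (hwi : Integrable (Function.uncurry w) (prodVariation μ ν))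
    (hwi' : Integrable (Function.uncurry w') (prodVariation μ ν)) :
    weightedConv (fun f g => w f g - w' f g) μ ν =
      weightedConv w μ ν - weightedConv w' μ ν := by
  have hi : Integrable (Function.uncurry fun f g => w f g - w' f g) (prodVariation μ ν) :=
    hwi.sub hwi'
  refine Subtype.ext (VectorMeasure.ext fun s hs => ?_)
  rw [Submodule.coe_sub, sub_apply, weightedConv_apply (hw.sub hw') hi hs,
    weightedConv_apply hw hwi hs, weightedConv_apply hw' hwi' hs, ← integral_sub]
  · congr 1
    ext p
    ring
  all_goals
    refine integrable_mul_phase_mul_phase (integrable_mul_comp_add ?_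
      (measurable_const.indicator hs) (norm_indicator_one_le s))
    assumption

theorem weightedConv_const_mul {w : E → E → ℂ} (c : ℂ) (hw : FinDimMeasurable w)
    {μ ν : regMeasures E}
    (hwi : Integrable (Function.uncurry w) (prodVariation μ ν)) :
    weightedConv (fun f g => c * w f g) μ ν = c • weightedConv w μ ν := by
  have hi : Integrable (Function.uncurry fun f g => c * w f g) (prodVariation μ ν) :=
    hwi.const_mul c
  refine Subtype.ext (VectorMeasure.ext fun s hs => ?_)
  rw [Submodule.coe_smul, smul_apply, weightedConv_apply (hw.comp (measurable_const_mul c)) hi hs,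
    weightedConv_apply hw hwi hs, smul_eq_mul, ← integral_const_mul]
  congr 1
  ext p
  ring

theorem integrable_swap {w : E → E → ℂ} {μ ν : regMeasures E}
    (hwi : Integrable (Function.uncurry w) (prodVariation μ ν)) :
    Integrable (Function.uncurry fun f g => w g f) (prodVariation ν μ) :=
  Integrable.swap hwi

/-- Holds because addition is commutative. It rewrites `ν ⋆ μ` as a convolution of `μ` with `ν`, as
the commutator needs, and derives linearity on the right from linearity on the left. -/
theorem weightedConv_swap {w : E → E → ℂ} (hw : FinDimMeasurable w)
    {μ ν : regMeasures E} (hwi : Integrable (Function.uncurry w) (prodVariation μ ν)) :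
    weightedConv (fun f g => w g f) ν μ = weightedConv w μ ν := by
  refine Subtype.ext (VectorMeasure.ext fun s hs => ?_)
  rw [weightedConv_apply hw.swap (integrable_swap hwi) hs, weightedConv_apply hw hwi hs,
    prodVariation, prodVariation, ← integral_prod_swap]
  congr 1
  ext p
  simp only [Prod.fst_swap, Prod.snd_swap, add_comm, mul_comm (phase _ p.2)]

theorem weightedConv_add_left {w : E → E → ℂ} (hw : FinDimMeasurable w) {C : ℝ}
    (hC : ∀ f g, ‖w f g‖ ≤ C) (μ μ' ν : regMeasures E) :
    weightedConv w (μ + μ') ν = weightedConv w μ ν + weightedConv w μ' ν := by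
  obtain ⟨S, hS, μ, μ', ν, rfl, rfl, rfl⟩ := exists_ofSubspace₃ μ μ' ν
  have := hS.measurableAdd₂
  have hadd : ofSubspace hS μ + ofSubspace hS μ' = ofSubspace hS (μ + μ') :=
    Subtype.ext (VectorMeasure.map_add _ _ _).symm
  rw [hadd, weightedConv_ofSubspace hS hw (hw.integrable_of_bound hC _ _),
    weightedConv_ofSubspace hS hw (hw.integrable_of_bound hC _ _),
    weightedConv_ofSubspace hS hw (hw.integrable_of_bound hC _ _)]
  rw [wconv_add_left (w := fun a b : S => w a b) (hS.measurable_restrict hw) (fun f g => hC f g)]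
  exact Subtype.ext (VectorMeasure.map_add _ _ _)

theorem weightedConv_smul_left {w : E → E → ℂ} (hw : FinDimMeasurable w) {C : ℝ}
    (hC : ∀ f g, ‖w f g‖ ≤ C) (c : ℂ) (μ ν : regMeasures E) :
    weightedConv w (c • μ) ν = c • weightedConv w μ ν := by
  obtain ⟨S, hS, μ, ν, rfl, rfl⟩ := exists_ofSubspace₂ μ ν
  have := hS.measurableAdd₂
  have hsmul : c • ofSubspace hS μ = ofSubspace hS (c • μ) :=
    Subtype.ext (VectorMeasure.map_smul c).symm
  rw [hsmul, weightedConv_ofSubspace hS hw (hw.integrable_of_bound hC _ _),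
    weightedConv_ofSubspace hS hw (hw.integrable_of_bound hC _ _),
    wconv_smul_left (w := fun a b : S => w a b) (hS.measurable_restrict hw) (fun f g => hC f g)]
  exact Subtype.ext (VectorMeasure.map_smul c)

theorem weightedConv_add_right {w : E → E → ℂ} (hw : FinDimMeasurable w) {C : ℝ}
    (hC : ∀ f g, ‖w f g‖ ≤ C) (μ ν ν' : regMeasures E) :
    weightedConv w μ (ν + ν') = weightedConv w μ ν + weightedConv w μ ν' := by
  simp only [← weightedConv_swap hw (hw.integrable_of_bound hC _ _)]
  exact weightedConv_add_left hw.swap (fun f g => hC g f) ν ν' μ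

theorem weightedConv_smul_right {w : E → E → ℂ} (hw : FinDimMeasurable w) {C : ℝ}
    (hC : ∀ f g, ‖w f g‖ ≤ C) (c : ℂ) (μ ν : regMeasures E) :
    weightedConv w μ (c • ν) = c • weightedConv w μ ν := by
  simp only [← weightedConv_swap hw (hw.integrable_of_bound hC _ _)]
  exact weightedConv_smul_left hw.swap (fun f g => hC g f) c ν μ

theorem weightedConv_assoc {w : E → E → ℂ} (hw : FinDimMeasurable w) {C : ℝ}
    (hC : ∀ f g, ‖w f g‖ ≤ C)
    (hcoc : ∀ f g h, w f g * w (f + g) h = w g h * w f (g + h)) (μ ν κ : regMeasures E) :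
    weightedConv w (weightedConv w μ ν) κ = weightedConv w μ (weightedConv w ν κ) := by
  obtain ⟨S, hS, μ, ν, κ, rfl, rfl, rfl⟩ := exists_ofSubspace₃ μ ν κ
  have := hS.measurableAdd₂
  have hi := hw.integrable_of_bound hC
  simp only [weightedConv_ofSubspace hS hw (hi _ _)]
  rw [wconv_assoc (w := fun a b : S => w a b) (hS.measurable_restrict hw) (fun f g => hC f g) fun f g h => hcoc f g h]

end WeightedConvolution

/-! ### The Weyl multiplier. -/

section Multiplier

variable {E : Type u} [AddCommGroup E] [Module ℝ E] (σ : LinearMap.BilinForm ℝ E) (ħ : ℝ)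

theorem multiplier_eq_exp (f g : E) :
    multiplier σ ħ f g = Complex.exp ((-(ħ * σ f g) / 2 : ℝ) * Complex.I) := by
  rw [multiplier]
  congr 1
  push_cast
  ring

theorem norm_multiplier (f g : E) : ‖multiplier σ ħ f g‖ = 1 := by
  rw [multiplier_eq_exp, Complex.norm_exp_ofReal_mul_I]

/-- Bilinearity alone: both exponents contain `σ(f,g) + σ(f,h) + σ(g,h)`. -/
theorem multiplier_cocycle (f g h : E) : multiplier σ ħ f g * multiplier σ ħ (f + g) h =
    multiplier σ ħ g h * multiplier σ ħ f (g + h) := by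
  simp only [multiplier_eq_exp, ← Complex.exp_add, map_add, LinearMap.add_apply]
  congr 1
  push_cast
  ring

@[simp]
theorem multiplier_zero_left (g : E) : multiplier σ ħ 0 g = 1 := by
  simp [multiplier]

@[simp]
theorem multiplier_zero_right (f : E) : multiplier σ ħ f 0 = 1 := by
  simp [multiplier]

variable [TopologicalSpace E] [IsTopologicalAddGroup E] [ContinuousSMul ℝ E] [T2Space E]
  [MeasurableSpace E] [BorelSpace E]

theorem finDimMeasurable_multiplier : FinDimMeasurable (multiplier σ ħ) := by
  have : Measurable fun t : ℝ => Complex.exp (-(Complex.I / 2) * (ħ : ℂ) * (t : ℂ)) := by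
    fun_prop
  exact (finDimMeasurable_bilinForm σ).comp this

theorem integrable_multiplier (μ ν : regMeasures E) :
    Integrable (Function.uncurry (multiplier σ ħ)) (prodVariation μ ν) :=
  (finDimMeasurable_multiplier σ ħ).integrable_of_bound (fun f g => (norm_multiplier σ ħ f g).le)
    μ ν

theorem isWeightedConv_twistedConv (μ ν : regMeasures E) :
    IsWeightedConv (multiplier σ ħ) μ ν (twistedConv σ ħ μ ν) :=
  isWeightedConv_weightedConv (finDimMeasurable_multiplier σ ħ) (integrable_multiplier σ ħ μ ν)

end Multiplier

/-! ### Absolutely convergent series of complex measures. -/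

section Series

variable {X : Type*} [MeasurableSpace X]

theorem norm_apply_le_variation_univ (μ : ComplexMeasure X) (s : Set X) :
    ‖μ s‖ ≤ μ.variation.real Set.univ :=
  (VectorMeasure.norm_measure_le_variation (measure_ne_top _ _)).trans
    (ENNReal.toReal_mono (measure_ne_top _ _) (measure_mono (Set.subset_univ _)))

/-- The sum of an absolutely convergent series of complex measures. -/
noncomputable def seriesMeasure (μ : ℕ → ComplexMeasure X)
    (h : Summable fun n => (μ n).variation.real Set.univ) : ComplexMeasure X where
  measureOf' s := ∑' n, μ n s
  empty' := by simp
  not_measurable' s hs := by simp [VectorMeasure.not_measurable _ hs]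
  m_iUnion' f hf hd := by
    have hs : ∀ s, Summable fun n => μ n s := fun s =>
      Summable.of_norm_bounded h fun n => norm_apply_le_variation_univ (μ n) s
    -- Countable additivity is an exchange of limits: finite additivity moves the partial sums
    -- inside the series over `n`, and dominated convergence with bounds `|μ n|(X)` passes to the
    -- limit.
    have key : ∀ A : Finset ℕ, ∑ i ∈ A, ∑' n, μ n (f i) = ∑' n, μ n (⋃ i ∈ A, f i) := by
      intro A
      rw [← Summable.tsum_finsetSum fun i _ => hs (f i)]
      congr 1
      ext n
      rw [VectorMeasure.of_biUnion_finset (fun i _ k _ hik => hd hik) fun i _ => hf i]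
    rw [HasSum]
    simp only [key]
    refine tendsto_tsum_of_dominated_convergence h (fun n => ?_)
      (Eventually.of_forall fun A n => norm_apply_le_variation_univ (μ n) _)
    have := VectorMeasure.hasSum_of_disjoint_iUnion (v := μ n) hf hd
    refine Tendsto.congr (fun A => ?_) this
    rw [VectorMeasure.of_biUnion_finset (fun i _ k _ hik => hd hik) fun i _ => hf i]

theorem variation_seriesMeasure_sub_le (μ : ℕ → ComplexMeasure X)
    (h : Summable fun n => (μ n).variation.real Set.univ) (n : ℕ) :
    (seriesMeasure μ h - ∑ i ∈ Finset.range n, μ i).variation Set.univ ≤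
      ∑' k, (μ (k + n)).variation Set.univ := by
  have key : (seriesMeasure μ h - ∑ i ∈ Finset.range n, μ i).variation ≤
      Measure.sum fun k => (μ (k + n)).variation := by
    refine VectorMeasure.variation_le_of_forall_enorm_le fun s hs => ?_
    have hsum : Summable fun n => μ n s :=
      Summable.of_norm_bounded h fun n => norm_apply_le_variation_univ (μ n) s
    have e : (seriesMeasure μ h - ∑ i ∈ Finset.range n, μ i) s = ∑' k, μ (k + n) s := by
      have e0 : seriesMeasure μ h s = ∑' n, μ n s := rfl
      rw [sub_apply, e0, sub_eq_iff_eq_add', ← hsum.sum_add_tsum_nat_add n]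
      simp
    rw [e, Measure.sum_apply _ hs]
    exact enorm_tsum_le_tsum_enorm.trans
      (ENNReal.tsum_le_tsum fun k => VectorMeasure.enorm_measure_le_variation _ _)
  refine (key Set.univ).trans ?_
  rw [Measure.sum_apply _ MeasurableSet.univ]

end Series

/-! ### The total variation norm: unit, submultiplicativity and completeness. -/

section TotalVariation

variable {E : Type u} [AddCommGroup E] [Module ℝ E] [TopologicalSpace E]
  [IsTopologicalAddGroup E] [ContinuousSMul ℝ E] [T2Space E] [MeasurableSpace E] [BorelSpace E]

/-- The unit of the convolution algebras: the point measure at the origin. -/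
noncomputable def diracZero : regMeasures E :=
  ⟨VectorMeasure.dirac 0 1, fun ε _ => ⟨⊥, inferInstance, VectorMeasure.dirac 0 1,
    fun s hs => by
      have h0 : MeasurableSet ((⊥ : Submodule ℝ E) : Set E) :=
        measurableSet_finiteDimensional E ⊥
      by_cases h : (0 : E) ∈ s
      · rw [VectorMeasure.dirac_apply_of_mem hs h,
          VectorMeasure.dirac_apply_of_mem (hs.inter h0) ⟨h, zero_mem _⟩]
      · rw [VectorMeasure.dirac_apply_of_notMem h,
          VectorMeasure.dirac_apply_of_notMem fun h' => h h'.1],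
    by simp⟩⟩

theorem cintegral_diracZero (φ : E → ℂ) :
    cintegral (diracZero : regMeasures E) φ = φ 0 := by
  simp [cintegral, diracZero]

theorem twistedConv_diracZero_left (σ : LinearMap.BilinForm ℝ E) (ħ : ℝ) (μ : regMeasures E) :
    twistedConv σ ħ diracZero μ = μ := by
  refine (isWeightedConv_twistedConv σ ħ diracZero μ).unique fun s hs => ?_
  simp [cintegral_diracZero, cintegral_indicator_one _ hs]

theorem twistedConv_diracZero_right (σ : LinearMap.BilinForm ℝ E) (ħ : ℝ) (μ : regMeasures E) :
    twistedConv σ ħ μ diracZero = μ := by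
  refine (isWeightedConv_twistedConv σ ħ μ diracZero).unique fun s hs => ?_
  simp [cintegral_diracZero, cintegral_indicator_one _ hs]

theorem ofReal_tvNorm (μ : regMeasures E) :
    ENNReal.ofReal (tvNorm μ) = (μ : ComplexMeasure E).variation Set.univ :=
  ENNReal.ofReal_toReal (measure_ne_top _ _)

theorem tvNorm_nonneg (μ : regMeasures E) : 0 ≤ tvNorm μ := ENNReal.toReal_nonneg

theorem norm_apply_le_tvNorm (μ : regMeasures E) (s : Set E) :
    ‖(μ : ComplexMeasure E) s‖ ≤ tvNorm μ :=
  (VectorMeasure.norm_measure_le_variation (measure_ne_top _ _)).trans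
    (ENNReal.toReal_mono (measure_ne_top _ _) (measure_mono (Set.subset_univ _)))

theorem tvNorm_add_le (μ ν : regMeasures E) : tvNorm (μ + ν) ≤ tvNorm μ + tvNorm ν := by
  rw [tvNorm, tvNorm, tvNorm, ← ENNReal.toReal_add (measure_ne_top _ _) (measure_ne_top _ _)]
  exact ENNReal.toReal_mono (ENNReal.add_ne_top.2 ⟨measure_ne_top _ _, measure_ne_top _ _⟩)
    (VectorMeasure.variation_add_le Set.univ)

theorem tvNorm_smul (c : ℂ) (μ : regMeasures E) : tvNorm (c • μ) = ‖c‖ * tvNorm μ := by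
  rw [tvNorm, tvNorm, Submodule.coe_smul, VectorMeasure.variation_smul, ← toReal_enorm,
    ← ENNReal.toReal_mul]
  rfl

@[simp]
theorem tvNorm_zero : tvNorm (0 : regMeasures E) = 0 := by
  rw [← zero_smul ℂ (0 : regMeasures E), tvNorm_smul, norm_zero, zero_mul]

theorem tvNorm_neg (μ : regMeasures E) : tvNorm (-μ) = tvNorm μ := by
  rw [← neg_one_smul ℂ μ, tvNorm_smul, norm_neg, norm_one, one_mul]

theorem tvNorm_diracZero : tvNorm (diracZero : regMeasures E) = 1 := by
  simp [tvNorm, diracZero]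

theorem tvNorm_invol_le (μ : regMeasures E) : tvNorm (invol μ) ≤ tvNorm μ := by
  have key : (involution (μ : ComplexMeasure E)).variation ≤
      (μ : ComplexMeasure E).variation.map fun f : E => -f := by
    refine VectorMeasure.variation_le_of_forall_enorm_le fun s hs => ?_
    rw [involution_apply _ hs, Measure.map_apply continuous_neg.measurable hs]
    refine le_trans (le_of_eq ?_) (VectorMeasure.enorm_measure_le_variation _ _)
    rw [← ofReal_norm, RCLike.norm_conj, ofReal_norm]
    rfl
  refine ENNReal.toReal_mono (measure_ne_top _ _) ((key Set.univ).trans ?_)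
  rw [Measure.map_apply continuous_neg.measurable MeasurableSet.univ, Set.preimage_univ]

theorem tvNorm_twistedConv_le (σ : LinearMap.BilinForm ℝ E) (ħ : ℝ) (μ ν : regMeasures E) :
    tvNorm (twistedConv σ ħ μ ν) ≤ tvNorm μ * tvNorm ν := by
  refine (tvNorm_weightedConv_le (finDimMeasurable_multiplier σ ħ)
    (integrable_multiplier σ ħ μ ν)).trans (le_of_eq ?_)
  simp only [norm_multiplier, integral_const, smul_eq_mul, mul_one]
  rw [measureReal_def, prodVariation, ← Set.univ_prod_univ, Measure.prod_prod, ENNReal.toReal_mul]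
  rfl

theorem eq_zero_of_tvNorm_eq_zero {μ : regMeasures E} (h : tvNorm μ = 0) : μ = 0 := by
  refine Subtype.ext (VectorMeasure.ext fun s _ => ?_)
  have := norm_apply_le_tvNorm μ s
  rw [h] at this
  simpa using this

/-- The closure is closed, by an `ε/2` argument; it places sums of series in `𝓜(E)`. -/
theorem mem_regMeasures_of_forall_variation_sub_le {ρ : ComplexMeasure E}
    (h : ∀ ε : ℝ≥0∞, ε ≠ 0 → ∃ ν ∈ regMeasures E, (ρ - ν).variation Set.univ ≤ ε) :
    ρ ∈ regMeasures E := by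
  intro ε hε
  have hε2 : ε / 2 ≠ 0 := (ENNReal.half_pos hε).ne'
  obtain ⟨ν, hν, h1⟩ := h _ hε2
  obtain ⟨V, hV, κ, hκ, h2⟩ := hν _ hε2
  refine ⟨V, hV, κ, hκ, ?_⟩
  have e : ρ - κ = (ρ - ν) + (ν - κ) := by abel
  rw [e]
  refine (VectorMeasure.variation_add_le Set.univ).trans ?_
  rw [Measure.add_apply]
  exact (add_le_add h1 h2).trans (ENNReal.add_halves ε).le

/-- Absolutely convergent series of measures converge in total variation. -/
theorem exists_tendsto_sum {μ : ℕ → regMeasures E} (h : Summable fun n => tvNorm (μ n)) :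
    ∃ ρ : regMeasures E,
      Tendsto (fun n => tvNorm (ρ - ∑ i ∈ Finset.range n, μ i)) atTop (𝓝 0) := by
  have hfin : ∑' n, (μ n : ComplexMeasure E).variation Set.univ ≠ ∞ := by
    simp only [← ofReal_tvNorm]
    exact h.tsum_ofReal_ne_top
  have hlim := ENNReal.tendsto_sum_nat_add _ hfin
  let ρ := seriesMeasure (fun n => (μ n : ComplexMeasure E)) h
  have hρ : ρ ∈ regMeasures E := by
    refine mem_regMeasures_of_forall_variation_sub_le fun ε hε => ?_
    obtain ⟨n, hn⟩ := (hlim.eventually (gt_mem_nhds (pos_iff_ne_zero.2 hε))).exists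
    exact ⟨∑ i ∈ Finset.range n, (μ i : ComplexMeasure E),
      Submodule.sum_mem _ fun i _ => (μ i).2, (variation_seriesMeasure_sub_le _ h n).trans hn.le⟩
  refine ⟨⟨ρ, hρ⟩, ?_⟩
  have hlim' := (ENNReal.tendsto_toReal ENNReal.zero_ne_top).comp hlim
  refine squeeze_zero (fun _ => tvNorm_nonneg _) (fun n => ?_) hlim'
  refine ENNReal.toReal_mono ?_ ?_
  · exact ne_top_of_le_ne_top hfin
      (ENNReal.tsum_comp_le_tsum_of_injective (add_left_injective n) _)
  · rw [Submodule.coe_sub, Submodule.coe_sum]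
    exact variation_seriesMeasure_sub_le _ h n

end TotalVariation

/-! ### The twisted Banach algebra and contractivity of representations. -/

section BanachAlgebra

variable {E : Type u} [AddCommGroup E] [Module ℝ E] [TopologicalSpace E]
  [IsTopologicalAddGroup E] [ContinuousSMul ℝ E] [T2Space E] [MeasurableSpace E] [BorelSpace E]

/-- The space `𝓜(E)`, considered as a Banach algebra with the twisted convolution product. -/
def TwistedAlgebra (_σ : LinearMap.BilinForm ℝ E) (_ħ : ℝ) : Type u := regMeasures E

variable {σ : LinearMap.BilinForm ℝ E} {ħ : ℝ}

namespace TwistedAlgebra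

noncomputable instance : AddCommGroup (TwistedAlgebra σ ħ) :=
  inferInstanceAs (AddCommGroup (regMeasures E))

noncomputable instance : Module ℂ (TwistedAlgebra σ ħ) :=
  inferInstanceAs (Module ℂ (regMeasures E))

noncomputable instance : NormedAddCommGroup (TwistedAlgebra σ ħ) :=
  AddGroupNorm.toNormedAddCommGroup
    { toFun := fun μ : TwistedAlgebra σ ħ => tvNorm (E := E) μ
      map_zero' := tvNorm_zero
      add_le' := tvNorm_add_le
      neg' := tvNorm_neg
      eq_zero_of_map_eq_zero' := fun _ h => eq_zero_of_tvNorm_eq_zero h }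

noncomputable instance : Ring (TwistedAlgebra σ ħ) where
  mul := twistedConv σ ħ
  one := diracZero (E := E)
  left_distrib := weightedConv_add_right (finDimMeasurable_multiplier σ ħ)
    (fun f g => (norm_multiplier σ ħ f g).le)
  right_distrib := weightedConv_add_left (finDimMeasurable_multiplier σ ħ)
    (fun f g => (norm_multiplier σ ħ f g).le)
  mul_assoc := weightedConv_assoc (finDimMeasurable_multiplier σ ħ)
    (fun f g => (norm_multiplier σ ħ f g).le) (multiplier_cocycle σ ħ)
  one_mul := twistedConv_diracZero_left σ ħ
  mul_one := twistedConv_diracZero_right σ ħ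
  zero_mul μ := by
    have := weightedConv_smul_left (finDimMeasurable_multiplier σ ħ)
      (fun f g => (norm_multiplier σ ħ f g).le) 0 0 μ
    rwa [zero_smul, zero_smul] at this
  mul_zero μ := by
    have := weightedConv_smul_right (finDimMeasurable_multiplier σ ħ)
      (fun f g => (norm_multiplier σ ħ f g).le) 0 μ 0
    rwa [zero_smul, zero_smul] at this
  neg_add_cancel := neg_add_cancel
  zsmul := fun n μ => n • μ
  zsmul_zero' := SubNegMonoid.zsmul_zero'
  zsmul_succ' := SubNegMonoid.zsmul_succ'
  zsmul_neg' := SubNegMonoid.zsmul_neg'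
  sub_eq_add_neg := sub_eq_add_neg

noncomputable instance : NormedRing (TwistedAlgebra σ ħ) where
  dist_eq := dist_eq_norm_neg_add
  norm_mul_le := tvNorm_twistedConv_le σ ħ

noncomputable instance : NormedAlgebra ℂ (TwistedAlgebra σ ħ) where
  toAlgebra := Algebra.ofModule
    (weightedConv_smul_left (finDimMeasurable_multiplier σ ħ)
      (fun f g => (norm_multiplier σ ħ f g).le))
    (fun c μ ν => weightedConv_smul_right (finDimMeasurable_multiplier σ ħ)
      (fun f g => (norm_multiplier σ ħ f g).le) c μ ν)
  norm_smul_le c μ := (tvNorm_smul c μ).le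

instance : CompleteSpace (TwistedAlgebra σ ħ) := by
  refine NormedAddCommGroup.completeSpace_of_summable_imp_tendsto fun μ h => ?_
  obtain ⟨ρ, hρ⟩ := exists_tendsto_sum (E := E) (μ := μ) h
  refine ⟨ρ, tendsto_iff_norm_sub_tendsto_zero.2 (hρ.congr fun n => ?_)⟩
  exact norm_sub_rev (E := TwistedAlgebra σ ħ) ρ (∑ i ∈ Finset.range n, μ i)

instance : NormOneClass (TwistedAlgebra σ ħ) := ⟨tvNorm_diracZero⟩

end TwistedAlgebra

variable {H : Type v} [NormedAddCommGroup H] [InnerProductSpace ℂ H] [CompleteSpace H]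

/-- A representation as a homomorphism of algebras. -/
noncomputable def MeasureRep.toHom (P : MeasureRep σ ħ H) :
    TwistedAlgebra σ ħ →ₙₐ[ℂ] (H →L[ℂ] H) where
  toFun := P.toLinearMap
  map_smul' := P.toLinearMap.map_smul
  map_zero' := P.toLinearMap.map_zero
  map_add' := P.toLinearMap.map_add
  map_mul' := P.map_conv

/-- Representations are contractive. -/
theorem MeasureRep.norm_le (P : MeasureRep σ ħ H) (μ : regMeasures E) :
    ‖P.toLinearMap μ‖ ≤ tvNorm μ := by
  -- By the C*-identity `‖Π(μ)‖² = ‖Π(a)‖` with `a = μ* ⋆ μ`, so it suffices to bound the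
  -- self-adjoint operator `Π(a)` by `‖a‖ ≤ ‖μ‖₁²`.
  let a : TwistedAlgebra σ ħ := twistedConv σ ħ (invol μ) μ
  have ha : P.toHom a = star (P.toLinearMap μ) * P.toLinearMap μ := by
    refine (P.map_conv (invol μ) μ).trans ?_
    rw [P.map_invol, ContinuousLinearMap.star_eq_adjoint]
  have hna : ‖a‖ ≤ tvNorm μ * tvNorm μ :=
    (tvNorm_twistedConv_le σ ħ _ _).trans
      (mul_le_mul_of_nonneg_right (tvNorm_invol_le μ) (tvNorm_nonneg μ))
  have hsa : IsSelfAdjoint (P.toHom a) := ha ▸ IsSelfAdjoint.star_mul_self _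
  have hspec : spectralRadius ℂ (P.toHom a) ≤ ‖a‖₊ := by
    refine iSup₂_le fun k hk => ?_
    -- `Π` need not send the unit to the identity operator, so spectra are compared through
    -- quasispectra. This adds only the point `0`, harmless for a radius bound.
    have h1 : k ∈ quasispectrum ℂ a := NonUnitalAlgHom.quasispectrum_apply_subset P.toHom a
      (spectrum_subset_quasispectrum ℂ _ hk)
    rw [quasispectrum_eq_spectrum_union_zero] at h1
    have h2 : ‖k‖ ≤ ‖a‖ := by
      rcases h1 with h1 | h1
      · exact spectrum.norm_le_norm_of_mem h1
      · rw [Set.mem_singleton_iff.1 h1, norm_zero]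
        exact norm_nonneg a
    exact_mod_cast h2
  rw [hsa.spectralRadius_eq_nnnorm, ha] at hspec
  have h3 : ‖star (P.toLinearMap μ) * P.toLinearMap μ‖ ≤ ‖a‖ := by exact_mod_cast hspec
  rw [CStarRing.norm_star_mul_self] at h3
  exact (mul_self_le_mul_self_iff (norm_nonneg _) (tvNorm_nonneg μ)).2 (h3.trans hna)

end BanachAlgebra

/-! ### Uniqueness for Fourier transforms of complex measures. -/

section Uniqueness

variable {W : Type*} [NormedAddCommGroup W] [NormedSpace ℝ W] [MeasurableSpace W] [BorelSpace W]
  [SecondCountableTopology W] [CompleteSpace W]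

/-- The Fourier transform is injective on signed measures. -/
theorem signedMeasure_eq_zero_of_forall_integral_exp {s : SignedMeasure W}
    (h : ∀ L : StrongDual ℝ W, ∫ x, Complex.exp (Complex.I * ((L x : ℝ) : ℂ))
      ∂s.toJordanDecomposition.posPart = ∫ x, Complex.exp (Complex.I * ((L x : ℝ) : ℂ))
      ∂s.toJordanDecomposition.negPart) : s = 0 := by
  have key : s.toJordanDecomposition.posPart = s.toJordanDecomposition.negPart := by
    refine Measure.ext_of_charFunDual ?_
    ext L
    simp only [charFunDual_apply, mul_comm _ Complex.I]
    exact h L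
  rw [← s.toSignedMeasure_toJordanDecomposition, JordanDecomposition.toSignedMeasure]
  simp [key]

/-- Let `a`, `b` be the transforms of the real and imaginary parts, so `a + ib = 0`. Passing from
`L` to `-L` conjugates `a` and `b`, and conjugating the resulting equation gives `a - ib = 0`; hence
both vanish. -/
theorem complexMeasure_eq_zero_of_forall_cintegral_exp {μ : ComplexMeasure W}
    (h : ∀ L : StrongDual ℝ W,
      cintegral μ (fun x => Complex.exp (Complex.I * ((L x : ℝ) : ℂ))) = 0) : μ = 0 := by
  have hconj : ∀ (m : Measure W) (L : StrongDual ℝ W),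
      ∫ x, Complex.exp (Complex.I * (((-L) x : ℝ) : ℂ)) ∂m =
        starRingEnd ℂ (∫ x, Complex.exp (Complex.I * ((L x : ℝ) : ℂ)) ∂m) := by
    intro m L
    rw [← integral_conj]
    congr 1
    ext x
    rw [← Complex.exp_conj]
    simp
  have hexp : ∀ L : StrongDual ℝ W, cintegral μ _ = _ := fun L =>
    cintegral_eq_integral_jordan μ (φ := fun x => Complex.exp (Complex.I * ((L x : ℝ) : ℂ)))
      (Continuous.measurable (by fun_prop)) (C := 1)
      fun x => by rw [mul_comm, Complex.norm_exp_ofReal_mul_I]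
  have key : ∀ a b : ℂ, a + Complex.I * b = 0 →
      starRingEnd ℂ a + Complex.I * starRingEnd ℂ b = 0 → a = 0 ∧ b = 0 := by
    intro a b h1 h2
    have h3 := congrArg (starRingEnd ℂ) h2
    simp only [map_add, map_mul, Complex.conj_conj, Complex.conj_I, map_zero] at h3
    have ha : a = 0 := by linear_combination (h1 + h3) / 2
    refine ⟨ha, ?_⟩
    rw [ha, zero_add] at h1
    exact (mul_eq_zero.1 h1).resolve_left Complex.I_ne_zero
  have h1 := fun L : StrongDual ℝ W => (hexp L).symm.trans (h L)
  have h2 := fun L : StrongDual ℝ W => key _ _ (h1 L) (by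
    have := h1 (-L)
    simp only [hconj, ← map_sub] at this
    exact this)
  rw [← μ.toComplexMeasure_to_signedMeasure,
    signedMeasure_eq_zero_of_forall_integral_exp fun L => sub_eq_zero.1 (h2 L).1,
    signedMeasure_eq_zero_of_forall_integral_exp fun L => sub_eq_zero.1 (h2 L).2]
  ext s hs
  simp [SignedMeasure.toComplexMeasure_apply, Complex.ext_iff]

end Uniqueness

section

variable {E : Type u} [AddCommGroup E] [Module ℝ E] [TopologicalSpace E]
  [IsTopologicalAddGroup E] [ContinuousSMul ℝ E] [T2Space E]

/-- Local convexity enters here: continuous functionals separate points, so the coordinates of `V`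
extend to continuous functionals on `E`. -/
theorem exists_continuousLinearMap_injOn [LocallyConvexSpace ℝ E] (V : Submodule ℝ E)
    [FiniteDimensional ℝ V] :
    ∃ T : E →L[ℝ] EuclideanSpace ℝ (Fin (Module.finrank ℝ V)), Set.InjOn T (V : Set E) := by
  have hsurj : Function.Surjective (V.subtype.dualMap ∘ ContinuousLinearMap.toLinearMap) :=
    (SeparatingDual.dualMap_surjective_iff (V := E)).2 V.injective_subtype
  let b := Module.finBasis ℝ V
  choose F hF using fun i => hsurj (b.coord i)
  refine ⟨(EuclideanSpace.equiv _ ℝ).symm.toContinuousLinearMap ∘L ContinuousLinearMap.pi F,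
    fun x hx y hy hxy => ?_⟩
  have h1 : ∀ i, F i x = F i y := fun i => by
    exact congrArg (fun z => z i) hxy
  have h2 : (⟨x, hx⟩ : V) = ⟨y, hy⟩ := by
    refine b.ext_elem fun i => ?_
    have hx' := LinearMap.congr_fun (hF i) ⟨x, hx⟩
    have hy' := LinearMap.congr_fun (hF i) ⟨y, hy⟩
    exact hx'.symm.trans ((h1 i).trans hy')
  exact congrArg Subtype.val h2

end

/-! ### Injectivity and product formulas for the Fourier transform on `𝓜(E)`. -/

section Fourier

variable {E : Type u} [AddCommGroup E] [Module ℝ E] [TopologicalSpace E]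
  [IsTopologicalAddGroup E] [ContinuousSMul ℝ E] [T2Space E] [MeasurableSpace E] [BorelSpace E]

theorem norm_exp_I_mul_ofReal (t : ℝ) : ‖Complex.exp (Complex.I * (t : ℂ))‖ = 1 := by
  rw [mul_comm, Complex.norm_exp_ofReal_mul_I]

theorem measureFourier_sub (μ ν : regMeasures E) :
    measureFourier (μ - ν) = measureFourier μ - measureFourier ν := by
  ext F
  have hint : ∀ ν : regMeasures E, (ν : ComplexMeasure E).Integrable
      fun f => Complex.exp (Complex.I * ((F f : ℝ) : ℂ)) := fun ν =>
    Integrable.of_bound (Measurable.aestronglyMeasurable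
      (Continuous.measurable (by fun_prop))) 1 (ae_of_all _ fun x => (norm_exp_I_mul_ofReal _).le)
  exact VectorMeasure.integral_sub_vectorMeasure (hint μ) (hint ν)

/-- Let `T` map `E` continuously to a finite dimensional space, injectively on `V`. The image of `μ`
under `T` has zero transform, hence vanishes. For `s ⊆ V` the set `T⁻¹(T s)` exceeds `s` only by
points outside `V`, so `|μ(s)|` is at most `|μ|` of the complement of `V`, which can be made small.
-/
theorem eq_zero_of_measureFourier_eq_zero [LocallyConvexSpace ℝ E] {μ : regMeasures E}
    (h : measureFourier μ = 0) : μ = 0 := by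
  have key : ∀ (V : Submodule ℝ E) [FiniteDimensional ℝ V] (s : Set E), MeasurableSet s →
      s ⊆ V → ‖(μ : ComplexMeasure E) s‖ₑ ≤ (μ : ComplexMeasure E).variation (V : Set E)ᶜ := by
    intro V _ s hs hsV
    have hVm := measurableSet_finiteDimensional E V
    obtain ⟨T, hT⟩ := exists_continuousLinearMap_injOn V
    have hTm : Measurable T := T.continuous.measurable
    have hzero : (μ : ComplexMeasure E).map T = 0 := by
      refine complexMeasure_eq_zero_of_forall_cintegral_exp fun L => ?_
      rw [cintegral_map hTm _ (Continuous.measurable (by fun_prop)) (C := 1)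
        fun y => (norm_exp_I_mul_ofReal _).le]
      exact congrFun h (L ∘L T)
    -- On the finite dimensional `V` the injective linear map `T` is a closed embedding, so it sends
    -- Borel sets to Borel sets.
    have himg : MeasurableSet (T '' s) := by
      have hinj : Function.Injective (T.toLinearMap ∘ₗ V.subtype) := fun v w hvw =>
        Subtype.ext (hT v.2 w.2 hvw)
      have hemb : MeasurableEmbedding (T.toLinearMap ∘ₗ V.subtype) :=
        (LinearMap.isClosedEmbedding_of_injective
          (LinearMap.ker_eq_bot.2 hinj)).measurableEmbedding
      have himage : T '' s = (T.toLinearMap ∘ₗ V.subtype) '' (Subtype.val ⁻¹' s) := by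
        ext y
        constructor
        · rintro ⟨x, hx, rfl⟩
          exact ⟨⟨x, hsV hx⟩, hx, rfl⟩
        · rintro ⟨x, hx, rfl⟩
          exact ⟨x, hx, rfl⟩
      rw [himage]
      exact hemb.measurableSet_image.2 (measurable_subtype_coe hs)
    have h0 : (μ : ComplexMeasure E) (T ⁻¹' (T '' s)) = 0 := by
      rw [← VectorMeasure.map_apply _ hTm himg, hzero]
      rfl
    have hsub : s ⊆ T ⁻¹' (T '' s) := Set.subset_preimage_image T s
    have hadd := VectorMeasure.of_add_of_sdiff (v := (μ : ComplexMeasure E)) hs (hTm himg) hsub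
    rw [h0, add_eq_zero_iff_eq_neg] at hadd
    rw [hadd, enorm_neg]
    refine (VectorMeasure.enorm_measure_le_variation _ _).trans (measure_mono ?_)
    rintro x ⟨⟨y, hy, hyx⟩, hx⟩ hxV
    exact hx (hT (hsV hy) hxV hyx ▸ hy)
  refine Subtype.ext (VectorMeasure.ext fun s hs => ?_)
  refine enorm_eq_zero.1 (le_antisymm (ENNReal.le_of_forall_pos_le_add fun ε hε _ => ?_) zero_le)
  obtain ⟨V, hV, hVε⟩ := exists_variation_compl_le μ.2 (ε := (ε : ℝ≥0∞) / 2)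
    (ENNReal.half_pos (by simpa using hε.ne')).ne'
  have hVm := measurableSet_finiteDimensional E V
  have h1 := VectorMeasure.of_add_of_sdiff (v := (μ : ComplexMeasure E)) (hs.inter hVm) hs
    Set.inter_subset_left
  rw [Set.sdiff_self_inter] at h1
  rw [zero_add, ← h1, ← ENNReal.add_halves (ε : ℝ≥0∞)]
  refine (enorm_add_le _ _).trans (add_le_add ?_ ?_)
  · exact (key V _ (hs.inter hVm) Set.inter_subset_right).trans hVε
  · exact ((VectorMeasure.enorm_measure_le_variation _ _).trans
      (measure_mono fun x hx => hx.2)).trans hVε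

theorem measureFourier_injective [LocallyConvexSpace ℝ E] :
    Function.Injective (measureFourier : regMeasures E → StrongDual ℝ E → ℂ) := fun μ ν h =>
  sub_eq_zero.1 (eq_zero_of_measureFourier_eq_zero
    (by rw [measureFourier_sub, h, sub_self]))

theorem quantMap_measureFourier [LocallyConvexSpace ℝ E] {σ : LinearMap.BilinForm ℝ E} {ħ : ℝ}
    {H : Type v} [NormedAddCommGroup H] [InnerProductSpace ℂ H] [CompleteSpace H]
    (P : MeasureRep σ ħ H) (μ : regMeasures E) :
    quantMap P (measureFourier μ) = P.toLinearMap μ := by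
  have h : ∃ ν : regMeasures E, measureFourier ν = measureFourier μ := ⟨μ, rfl⟩
  rw [quantMap, dif_pos h, measureFourier_injective h.choose_spec]

/-- The Fourier transform of a weighted convolution as an iterated integral. -/
theorem measureFourier_weightedConv {w : E → E → ℂ} (hw : FinDimMeasurable w)
    {μ ν : regMeasures E} (hwi : Integrable (Function.uncurry w) (prodVariation μ ν))
    (F : StrongDual ℝ E) :
    measureFourier (weightedConv w μ ν) F =
      cintegral (μ : ComplexMeasure E) fun f => cintegral (ν : ComplexMeasure E) fun g =>
        w f g * (Complex.exp (Complex.I * ((F f : ℝ) : ℂ)) *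
          Complex.exp (Complex.I * ((F g : ℝ) : ℂ))) := by
  rw [measureFourier, cintegral_weightedConv hw hwi (Continuous.measurable (by fun_prop)) (C := 1)
    fun y => (norm_exp_I_mul_ofReal _).le]
  simp only [map_add, Complex.ofReal_add, mul_add, Complex.exp_add]

/-- At `ħ = 0` the weight is `1` and the double integral factors. The pointwise product thus
corresponds to a convolution comparable with `⋆_ħ`. -/
theorem measureFourier_twistedConv_zero (σ : LinearMap.BilinForm ℝ E) (μ ν : regMeasures E) :
    measureFourier (twistedConv σ 0 μ ν) = measureFourier μ * measureFourier ν := by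
  ext F
  rw [twistedConv, measureFourier_weightedConv (finDimMeasurable_multiplier σ 0)
    (integrable_multiplier σ 0 μ ν)]
  simp only [multiplier, Complex.ofReal_zero, mul_zero, zero_mul, Complex.exp_zero, one_mul,
    cintegral_const_mul, Pi.mul_apply]
  simp only [mul_comm (Complex.exp _) (cintegral _ _), cintegral_const_mul]
  rw [mul_comm]
  rfl

end Fourier

/-! ### Von Neumann's condition. -/

section VonNeumann

variable {E : Type u} [AddCommGroup E] [Module ℝ E] [TopologicalSpace E]
  [IsTopologicalAddGroup E] [ContinuousSMul ℝ E] [T2Space E] [MeasurableSpace E] [BorelSpace E]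

theorem tendsto_integral_norm_multiplier_sub (σ : LinearMap.BilinForm ℝ E) (μ ν : regMeasures E) :
    Tendsto (fun ħ : ℝ => ∫ p, ‖multiplier σ ħ p.1 p.2 - multiplier σ 0 p.1 p.2‖
      ∂prodVariation μ ν) (𝓝 0) (𝓝 0) := by
  have h := tendsto_integral_filter_of_dominated_convergence (μ := prodVariation μ ν) (l := 𝓝 0)
    (F := fun (ħ : ℝ) (p : E × E) => ‖multiplier σ ħ p.1 p.2 - multiplier σ 0 p.1 p.2‖)
    (f := fun _ => 0) (fun _ => 2) ?_ ?_ (integrable_const _) ?_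
  · simpa using h
  · exact Eventually.of_forall fun ħ => (((finDimMeasurable_multiplier σ ħ).sub
      (finDimMeasurable_multiplier σ 0)).aestronglyMeasurable μ ν).norm
  · refine Eventually.of_forall fun ħ => ae_of_all _ fun p => ?_
    rw [norm_norm]
    refine (norm_sub_le _ _).trans (le_of_eq ?_)
    rw [norm_multiplier, norm_multiplier]
    norm_num
  · refine ae_of_all _ fun p => ?_
    have hc : Continuous fun ħ : ℝ => ‖multiplier σ ħ p.1 p.2 - multiplier σ 0 p.1 p.2‖ := by
      unfold multiplier
      fun_prop
    simpa using hc.tendsto 0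

/-- For each `ħ` the difference is the image under `Π_ħ` of one measure; contractivity bounds it by
an integral that no longer involves the representation. -/
theorem tendsto_vonNeumann [LocallyConvexSpace ℝ E] (σ : LinearMap.BilinForm ℝ E)
    (H : {ħ : ℝ // ħ ≠ 0} → Type v) [∀ ħ, NormedAddCommGroup (H ħ)]
    [∀ ħ, InnerProductSpace ℂ (H ħ)] [∀ ħ, CompleteSpace (H ħ)]
    (P : ∀ ħ : {ħ : ℝ // ħ ≠ 0}, MeasureRep σ ħ (H ħ)) (μ ν : regMeasures E) :
    Tendsto (fun ħ : {ħ : ℝ // ħ ≠ 0} =>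
      ‖quantMap (P ħ) (measureFourier μ) * quantMap (P ħ) (measureFourier ν) -
        quantMap (P ħ) (measureFourier μ * measureFourier ν)‖)
      (comap Subtype.val (𝓝 (0 : ℝ))) (𝓝 0) := by
  refine squeeze_zero (fun _ => norm_nonneg _) (fun ħ => ?_)
    ((tendsto_integral_norm_multiplier_sub σ μ ν).comp tendsto_comap)
  rw [← measureFourier_twistedConv_zero σ, quantMap_measureFourier, quantMap_measureFourier,
    quantMap_measureFourier, ← (P ħ).map_conv, ← map_sub, twistedConv, twistedConv,
    ← weightedConv_sub (finDimMeasurable_multiplier σ _) (finDimMeasurable_multiplier σ _)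
      (integrable_multiplier σ _ μ ν) (integrable_multiplier σ _ μ ν)]
  exact ((P ħ).norm_le _).trans (tvNorm_weightedConv_le
    ((finDimMeasurable_multiplier σ _).sub (finDimMeasurable_multiplier σ _))
    ((integrable_multiplier σ _ μ ν).sub (integrable_multiplier σ _ μ ν)))

end VonNeumann

/-! ### Dirac's condition. -/

section Dirac

variable {E : Type u} [AddCommGroup E] [Module ℝ E]

/-- The weight of the difference between the scaled commutator and the bracket of measures. -/
noncomputable def diracWeight (σ : LinearMap.BilinForm ℝ E) (ħ : ℝ) (f g : E) : ℂ :=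
  Complex.I / (ħ : ℂ) * (multiplier σ ħ f g - multiplier σ ħ g f) - ((σ f g : ℝ) : ℂ)

/-- By antisymmetry the two multipliers are complex conjugates, so their difference is a multiple of
a sine. -/
theorem diracWeight_eq {σ : LinearMap.BilinForm ℝ E} (hσ : σ.IsAlt) (ħ : ℝ) (f g : E) :
    diracWeight σ ħ f g = ((2 / ħ * Real.sin (ħ * σ f g / 2) - σ f g : ℝ) : ℂ) := by
  have h : σ g f = -σ f g := by rw [hσ.neg_eq]
  have e : multiplier σ ħ f g - multiplier σ ħ g f =
      -2 * Complex.I * Complex.sin ((ħ * σ f g / 2 : ℝ) : ℂ) := by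
    rw [multiplier_eq_exp, multiplier_eq_exp, h, Complex.sin]
    have h1 : (((-(ħ * σ f g) / 2 : ℝ) : ℂ)) * Complex.I =
        -(((ħ * σ f g / 2 : ℝ) : ℂ)) * Complex.I := by push_cast; ring
    have h2 : (((-(ħ * -σ f g) / 2 : ℝ) : ℂ)) * Complex.I =
        (((ħ * σ f g / 2 : ℝ) : ℂ)) * Complex.I := by push_cast; ring
    rw [h1, h2]
    linear_combination (Complex.exp (-(((ħ * σ f g / 2 : ℝ) : ℂ)) * Complex.I)
      - Complex.exp ((((ħ * σ f g / 2 : ℝ) : ℂ)) * Complex.I)) * Complex.I_mul_I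
  rw [diracWeight, e, ← Complex.ofReal_sin]
  push_cast
  linear_combination (-(2 / (ħ : ℂ) * Complex.sin (ħ * σ f g / 2))) * Complex.I_mul_I

/-- From `|sin x| ≤ |x|`; the bound is uniform in `ħ` and serves as the dominating function. -/
theorem norm_diracWeight_le {σ : LinearMap.BilinForm ℝ E} (hσ : σ.IsAlt) (ħ : ℝ) (f g : E) :
    ‖diracWeight σ ħ f g‖ ≤ 2 * |σ f g| := by
  rw [diracWeight_eq hσ, Complex.norm_real, Real.norm_eq_abs]
  have h : |2 / ħ * Real.sin (ħ * σ f g / 2)| ≤ |σ f g| := by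
    by_cases hħ : ħ = 0
    · simp [hħ]
    · calc |2 / ħ * Real.sin (ħ * σ f g / 2)| = |2 / ħ| * |Real.sin (ħ * σ f g / 2)| := abs_mul _ _
        _ ≤ |2 / ħ| * |ħ * σ f g / 2| :=
          mul_le_mul_of_nonneg_left Real.abs_sin_le_abs (abs_nonneg _)
        _ = |σ f g| := by
          rw [← abs_mul]
          congr 1
          field_simp
  have := abs_sub (2 / ħ * Real.sin (ħ * σ f g / 2)) (σ f g)
  linarith

/-- The sine term is the difference quotient at `0` of `t ↦ 2 sin(tσ(f,g)/2)`, whose derivative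
there is `σ(f,g)`. -/
theorem tendsto_norm_diracWeight {σ : LinearMap.BilinForm ℝ E} (hσ : σ.IsAlt) (f g : E) :
    Tendsto (fun ħ : {ħ : ℝ // ħ ≠ 0} => ‖diracWeight σ ħ f g‖)
      (comap Subtype.val (𝓝 (0 : ℝ))) (𝓝 0) := by
  have hd : HasDerivAt (fun t : ℝ => 2 * Real.sin (t * σ f g / 2)) (σ f g) 0 := by
    have h1 : HasDerivAt (fun t : ℝ => t * σ f g / 2) (1 * σ f g / 2) 0 :=
      ((hasDerivAt_id 0).mul_const _).div_const 2
    have h2 := (h1.sin).const_mul 2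
    have e : 2 * (Real.cos (0 * σ f g / 2) * (1 * σ f g / 2)) = σ f g := by
      rw [zero_mul, zero_div, Real.cos_zero]
      ring
    rwa [e] at h2
  have hlim := hasDerivAt_iff_tendsto_slope_zero.1 hd
  have hval : Tendsto (Subtype.val : {ħ : ℝ // ħ ≠ 0} → ℝ) (comap Subtype.val (𝓝 0)) (𝓝[≠] 0) :=
    tendsto_nhdsWithin_iff.2 ⟨tendsto_comap, Eventually.of_forall fun ħ => ħ.2⟩
  have h3 := (hlim.comp hval).sub_const (σ f g)
  rw [sub_self] at h3
  have h4 := h3.norm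
  rw [norm_zero] at h4
  refine h4.congr fun ħ => ?_
  rw [diracWeight_eq hσ, Complex.norm_real]
  simp only [Function.comp_apply, zero_add, zero_mul, zero_div, Real.sin_zero, mul_zero, sub_zero,
    smul_eq_mul]
  congr 1
  ring

variable [TopologicalSpace E]
  [IsTopologicalAddGroup E] [ContinuousSMul ℝ E] [T2Space E] [MeasurableSpace E] [BorelSpace E]

theorem integrable_of_mem_momentMeasures {ς : Seminorm ℝ E} (hς : Continuous ς)
    {μ : regMeasures E} (hμ : μ ∈ momentMeasures ς 1) :
    Integrable (fun f => ς f) (μ : ComplexMeasure E).variation := by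
  refine ⟨hς.measurable.aestronglyMeasurable, ?_⟩
  have := hμ 1 le_rfl
  simp only [pow_one] at this
  rw [hasFiniteIntegral_iff_ofReal (ae_of_all _ fun f => apply_nonneg ς f)]
  exact this

theorem finDimMeasurable_ofReal_bilinForm (σ : LinearMap.BilinForm ℝ E) :
    FinDimMeasurable fun f g : E => ((σ f g : ℝ) : ℂ) :=
  (finDimMeasurable_bilinForm σ).comp Complex.measurable_ofReal

/-- The first moments enter here: `c ς(f) ς(g)` dominates `|σ|` and is integrable as a product. -/
theorem integrable_bilinForm (σ : LinearMap.BilinForm ℝ E) {ς : Seminorm ℝ E}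
    (hς : Continuous ς) {c : ℝ} (hc : ∀ f g, |σ f g| ≤ c * ς f * ς g) {μ ν : regMeasures E}
    (hμ : μ ∈ momentMeasures ς 1) (hν : ν ∈ momentMeasures ς 1) :
    Integrable (Function.uncurry fun f g : E => ((σ f g : ℝ) : ℂ)) (prodVariation μ ν) := by
  refine Integrable.mono' (((integrable_of_mem_momentMeasures hς hμ).mul_prod
    (integrable_of_mem_momentMeasures hς hν)).const_mul c)
    ((finDimMeasurable_ofReal_bilinForm σ).aestronglyMeasurable μ ν) (ae_of_all _ fun p => ?_)
  simp only [Function.uncurry, Complex.norm_real, Real.norm_eq_abs]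
  rw [← mul_assoc]
  exact hc _ _

theorem finDimMeasurable_diracWeight (σ : LinearMap.BilinForm ℝ E) (ħ : ℝ) :
    FinDimMeasurable (diracWeight σ ħ) :=
  ((((finDimMeasurable_multiplier σ ħ).sub (finDimMeasurable_multiplier σ ħ).swap)).comp
    (measurable_const_mul _)).sub (finDimMeasurable_ofReal_bilinForm σ)

theorem weightedConv_diracWeight (σ : LinearMap.BilinForm ℝ E) (ħ : ℝ) {μ ν : regMeasures E}
    (hi : Integrable (Function.uncurry fun f g : E => ((σ f g : ℝ) : ℂ)) (prodVariation μ ν)) :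
    weightedConv (diracWeight σ ħ) μ ν =
      (Complex.I / (ħ : ℂ)) • (twistedConv σ ħ μ ν - twistedConv σ ħ ν μ) -
        measureBracket σ μ ν := by
  have hm := finDimMeasurable_multiplier σ ħ
  have hmi := integrable_multiplier σ ħ μ ν
  have hmi' := integrable_swap (integrable_multiplier σ ħ ν μ)
  have hd : Integrable (Function.uncurry fun f g => multiplier σ ħ f g - multiplier σ ħ g f)
    (prodVariation μ ν) := hmi.sub hmi'
  have h1 := weightedConv_sub ((hm.sub hm.swap).comp (measurable_const_mul (Complex.I / (ħ : ℂ))))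
    (finDimMeasurable_ofReal_bilinForm σ) (hd.const_mul (Complex.I / (ħ : ℂ))) hi
  refine h1.trans ?_
  rw [weightedConv_const_mul _ (hm.sub hm.swap) hd, weightedConv_sub hm hm.swap hmi hmi',
    weightedConv_swap hm (integrable_multiplier σ ħ ν μ)]
  rfl

theorem tendsto_integral_norm_diracWeight {σ : LinearMap.BilinForm ℝ E} (hσ : σ.IsAlt)
    {μ ν : regMeasures E}
    (hi : Integrable (Function.uncurry fun f g : E => ((σ f g : ℝ) : ℂ)) (prodVariation μ ν)) :
    Tendsto (fun ħ : {ħ : ℝ // ħ ≠ 0} => ∫ p, ‖diracWeight σ ħ p.1 p.2‖ ∂prodVariation μ ν)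
      (comap Subtype.val (𝓝 (0 : ℝ))) (𝓝 0) := by
  have h := tendsto_integral_filter_of_dominated_convergence (μ := prodVariation μ ν)
    (l := comap (Subtype.val : {ħ : ℝ // ħ ≠ 0} → ℝ) (𝓝 (0 : ℝ)))
    (F := fun ħ (p : E × E) => ‖diracWeight σ ħ p.1 p.2‖)
    (f := fun _ => 0) (fun p => 2 * ‖((σ p.1 p.2 : ℝ) : ℂ)‖) ?_ ?_ (hi.norm.const_mul 2) ?_
  · simpa using h
  · exact Eventually.of_forall fun ħ =>
      ((finDimMeasurable_diracWeight σ ħ).aestronglyMeasurable μ ν).norm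
  · refine Eventually.of_forall fun ħ => ae_of_all _ fun p => ?_
    rw [norm_norm, Complex.norm_real]
    exact norm_diracWeight_le hσ ħ p.1 p.2
  · exact ae_of_all _ fun p => tendsto_norm_diracWeight hσ p.1 p.2

theorem tendsto_dirac [LocallyConvexSpace ℝ E] {σ : LinearMap.BilinForm ℝ E} (hσ : σ.IsAlt)
    (H : {ħ : ℝ // ħ ≠ 0} → Type v) [∀ ħ, NormedAddCommGroup (H ħ)]
    [∀ ħ, InnerProductSpace ℂ (H ħ)] [∀ ħ, CompleteSpace (H ħ)]
    (P : ∀ ħ : {ħ : ℝ // ħ ≠ 0}, MeasureRep σ ħ (H ħ)) {μ ν : regMeasures E}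
    (hi : Integrable (Function.uncurry fun f g : E => ((σ f g : ℝ) : ℂ)) (prodVariation μ ν)) :
    Tendsto (fun ħ : {ħ : ℝ // ħ ≠ 0} =>
      ‖scaledCommutator ħ (quantMap (P ħ) (measureFourier μ))
        (quantMap (P ħ) (measureFourier ν)) -
        quantMap (P ħ) (measureFourier (measureBracket σ μ ν))‖)
      (comap Subtype.val (𝓝 (0 : ℝ))) (𝓝 0) := by
  refine squeeze_zero (fun _ => norm_nonneg _) (fun ħ => ?_)
    (tendsto_integral_norm_diracWeight hσ hi)
  have e : scaledCommutator ħ (quantMap (P ħ) (measureFourier μ))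
        (quantMap (P ħ) (measureFourier ν)) -
        quantMap (P ħ) (measureFourier (measureBracket σ μ ν)) =
      (P ħ).toLinearMap (weightedConv (diracWeight σ ħ) μ ν) := by
    have hsub : ∀ μ ν, (P ħ).toLinearMap (μ - ν) = (P ħ).toLinearMap μ - (P ħ).toLinearMap ν :=
      fun μ ν => map_sub _ μ ν
    rw [weightedConv_diracWeight σ ħ hi, hsub, map_smul, hsub, (P ħ).map_conv, (P ħ).map_conv,
      quantMap_measureFourier, quantMap_measureFourier, quantMap_measureFourier]
    rfl
  have hw : Integrable (Function.uncurry (diracWeight σ ħ)) (prodVariation μ ν) :=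
    Integrable.mono' (hi.norm.const_mul 2)
      ((finDimMeasurable_diracWeight σ ħ).aestronglyMeasurable μ ν) (ae_of_all _ fun p => by
        simp only [Function.uncurry, Complex.norm_real]
        exact norm_diracWeight_le hσ ħ p.1 p.2)
  rw [e]
  exact ((P ħ).norm_le _).trans (tvNorm_weightedConv_le (finDimMeasurable_diracWeight σ ħ) hw)

end Dirac

/-! ### Complexified bilinear forms under Bochner integrals. -/

section ComplexForm

variable {V : Type u} [NormedAddCommGroup V] [NormedSpace ℝ V]

/-- The element `z x` of the complexification `V + i V`, as a pair. -/
def complexPair (z : ℂ) (x : V) : V × V := (z.re • x, z.im • x)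

theorem norm_complexPair_le (z : ℂ) (x : V) : ‖complexPair z x‖ ≤ ‖z‖ * ‖x‖ := by
  refine norm_prod_le_iff.2 ⟨?_, ?_⟩
  · rw [complexPair, norm_smul]
    exact mul_le_mul_of_nonneg_right (Complex.abs_re_le_norm z) (norm_nonneg x)
  · rw [complexPair, norm_smul]
    exact mul_le_mul_of_nonneg_right (Complex.abs_im_le_norm z) (norm_nonneg x)

/-- The complex linear extension to `V + i V` of a real functional on `V`. -/
noncomputable def complexExtension (Γ : StrongDual ℝ V) : V × V →L[ℝ] ℂ :=
  Complex.ofRealCLM ∘L Γ ∘L ContinuousLinearMap.fst ℝ V V +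
    (ContinuousLinearMap.mul ℝ ℂ Complex.I) ∘L Complex.ofRealCLM ∘L Γ ∘L
      ContinuousLinearMap.snd ℝ V V

theorem complexExtension_apply (Γ : StrongDual ℝ V) (a : V × V) :
    complexExtension Γ a = ((Γ a.1 : ℝ) : ℂ) + Complex.I * ((Γ a.2 : ℝ) : ℂ) := rfl

theorem complexExtension_complexPair (Γ : StrongDual ℝ V) (z : ℂ) (x : V) :
    complexExtension Γ (complexPair z x) = z * ((Γ x : ℝ) : ℂ) := by
  rw [complexExtension_apply, complexPair]
  conv_rhs => rw [← Complex.re_add_im z]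
  simp only [map_smul, smul_eq_mul, Complex.ofReal_mul]
  ring

/-- Exhibits the form, for fixed `b`, as a continuous real linear map of `a`, so that it commutes
with the Bochner integral. -/
theorem complexForm_eq_left (s : V →L[ℝ] V →L[ℝ] ℝ) (a b : V × V) :
    complexForm s a b = (complexExtension (s.flip b.1) +
      (ContinuousLinearMap.mul ℝ ℂ Complex.I) ∘L complexExtension (s.flip b.2)) a := by
  change _ = complexExtension (s.flip b.1) a + Complex.I * complexExtension (s.flip b.2) a
  rw [complexExtension_apply, complexExtension_apply, complexForm]
  simp only [ContinuousLinearMap.flip_apply]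
  linear_combination (-((s a.2 b.2 : ℝ) : ℂ)) * Complex.I_mul_I

theorem complexForm_flip (s : V →L[ℝ] V →L[ℝ] ℝ) (a b : V × V) :
    complexForm s.flip a b = complexForm s b a := by
  simp only [complexForm, ContinuousLinearMap.flip_apply]
  ring

theorem complexForm_complexPair (s : V →L[ℝ] V →L[ℝ] ℝ) (z w : ℂ) (x y : V) :
    complexForm s (complexPair z x) (complexPair w y) = z * w * ((s x y : ℝ) : ℂ) := by
  rw [complexForm_eq_left]
  change complexExtension _ _ + Complex.I * complexExtension _ _ = _
  rw [complexExtension_complexPair, complexExtension_complexPair]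
  conv_rhs => rw [← Complex.re_add_im w]
  simp only [complexPair, map_smul, smul_apply, ContinuousLinearMap.flip_apply,
    smul_eq_mul, Complex.ofReal_mul]
  ring

variable [CompleteSpace V] {X Y : Type*} [MeasurableSpace X] [MeasurableSpace Y]

theorem complexForm_integral_left (s : V →L[ℝ] V →L[ℝ] ℝ) {m : Measure X} {a : X → V × V}
    (ha : Integrable a m) (b : V × V) :
    complexForm s (∫ x, a x ∂m) b = ∫ x, complexForm s (a x) b ∂m := by
  simp only [complexForm_eq_left]
  exact (ContinuousLinearMap.integral_comp_comm _ ha).symm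

theorem complexForm_integral_integral (s : V →L[ℝ] V →L[ℝ] ℝ) {m : Measure X} {n : Measure Y}
    {a : X → V × V} {b : Y → V × V} (ha : Integrable a m) (hb : Integrable b n) :
    complexForm s (∫ x, a x ∂m) (∫ y, b y ∂n) = ∫ x, ∫ y, complexForm s (a x) (b y) ∂n ∂m := by
  rw [complexForm_integral_left s ha]
  congr 1
  ext x
  rw [← complexForm_flip, complexForm_integral_left _ hb]
  simp only [complexForm_flip]

end ComplexForm

/-! ### The total differential of a Fourier transform and the Poisson bracket. -/

section Differential

variable {E : Type u} [AddCommGroup E] [Module ℝ E] [TopologicalSpace E]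
  [IsTopologicalAddGroup E]

theorem IsTotalDifferential.unique {ς : Seminorm ℝ E} {hς : Continuous ς}
    {A : StrongDual ℝ E → ℂ} {F : StrongDual ℝ E}
    {φ ψ : SeminormCompletion ς × SeminormCompletion ς}
    (hφ : IsTotalDifferential ς hς A F φ) (hψ : IsTotalDifferential ς hς A F ψ) : φ = ψ := by
  have h : ∀ Γ : StrongDual ℝ (SeminormCompletion ς), Γ φ.1 = Γ ψ.1 ∧ Γ φ.2 = Γ ψ.2 := fun Γ => by
    have e := (hφ Γ).unique (hψ Γ)
    have h1 := congrArg Complex.re e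
    have h2 := congrArg Complex.im e
    simp at h1 h2
    exact ⟨h1, h2⟩
  exact Prod.ext ((SeparatingDual.eq_iff_forall_dual_eq (R := ℝ)).2 fun Γ => (h Γ).1)
    ((SeparatingDual.eq_iff_forall_dual_eq (R := ℝ)).2 fun Γ => (h Γ).2)

theorem IsTotalDifferential.totalDifferential_eq {ς : Seminorm ℝ E} {hς : Continuous ς}
    {A : StrongDual ℝ E → ℂ} {F : StrongDual ℝ E}
    {φ : SeminormCompletion ς × SeminormCompletion ς} (hφ : IsTotalDifferential ς hς A F φ) :
    totalDifferential ς hς A F = φ := by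
  have h : ∃ φ, IsTotalDifferential ς hς A F φ := ⟨φ, hφ⟩
  rw [totalDifferential, dif_pos h]
  exact h.choose_spec.unique hφ

variable [ContinuousSMul ℝ E] [T2Space E] [MeasurableSpace E] [BorelSpace E]

/-- Bochner integrability needs separable range although `E` may be nonseparable. The measure lives
on a countable union of finite dimensional subspaces, whose images are separable. -/
theorem aestronglyMeasurable_of_continuous {Z : Type*} [TopologicalSpace Z]
    [TopologicalSpace.PseudoMetrizableSpace Z] {φ : E → Z} (hφ : Continuous φ) (μ : regMeasures E) :
    AEStronglyMeasurable φ (μ : ComplexMeasure E).variation := by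
  borelize Z
  obtain ⟨S, hS, hμ⟩ := exists_concentratedOn μ.2
  have h0 := hμ.variation_compl hS.measurableSet
  obtain ⟨V, -, hVf, hVS⟩ := hS
  refine aestronglyMeasurable_iff_aemeasurable_separable.2 ⟨hφ.measurable.aemeasurable,
    ⋃ n, φ '' (V n : Set E), TopologicalSpace.IsSeparable.iUnion fun n => ?_, ?_⟩
  · have := secondCountableTopology_of_finiteDimensional (V n)
    have h := (TopologicalSpace.isSeparable_range
      (hφ.comp (continuous_subtype_val (p := fun x => x ∈ V n))))
    rwa [Set.range_comp, Subtype.range_coe] at h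
  · refine measure_mono_null (t := (S : Set E)ᶜ) (fun x hx (hxS : x ∈ S) => hx ?_) h0
    obtain ⟨n, hn⟩ := Set.mem_iUnion.1 (hVS.subset hxS)
    exact Set.mem_iUnion.2 ⟨n, Set.mem_image_of_mem φ hn⟩

/-- The factor `i exp (i F(f))`, times the phase of `μ` at `f`. -/
noncomputable def fourierPhase (μ : regMeasures E) (F : StrongDual ℝ E) (f : E) : ℂ :=
  Complex.I * Complex.exp (Complex.I * ((F f : ℝ) : ℂ)) * phase (μ : ComplexMeasure E) f

theorem norm_fourierPhase (μ : regMeasures E) (F : StrongDual ℝ E) (f : E) :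
    ‖fourierPhase μ F f‖ = 1 := by
  rw [fourierPhase, norm_mul, norm_mul, norm_exp_I_mul_ofReal, norm_phase, Complex.norm_I, one_mul,
    one_mul]

theorem measurable_fourierPhase (μ : regMeasures E) (F : StrongDual ℝ E) :
    Measurable (fourierPhase μ F) :=
  (Continuous.measurable (by fun_prop)).mul (measurable_phase _)

theorem integrable_complexPair_fourierPhase {ς : Seminorm ℝ E} (hς : Continuous ς)
    {μ : regMeasures E} (hμ : μ ∈ momentMeasures ς 1) (F : StrongDual ℝ E) :
    Integrable (fun f => complexPair (fourierPhase μ F f) (toCompletion ς f))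
      (μ : ComplexMeasure E).variation := by
  have hm := measurable_fourierPhase μ F
  have hx : AEStronglyMeasurable (fun f => toCompletion ς f) (μ : ComplexMeasure E).variation :=
    aestronglyMeasurable_of_continuous (toCompletionL ς hς).continuous μ
  refine Integrable.mono' (integrable_of_mem_momentMeasures hς hμ)
    (((Complex.measurable_re.comp hm).aestronglyMeasurable.smul hx).prodMk
      ((Complex.measurable_im.comp hm).aestronglyMeasurable.smul hx)) (ae_of_all _ fun f => ?_)
  refine (norm_complexPair_le _ _).trans (le_of_eq ?_)
  rw [norm_fourierPhase, one_mul, norm_toCompletion]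

/-- The total differential of the Fourier transform of `μ` at `F`. -/
noncomputable def fourierDifferential (ς : Seminorm ℝ E) (μ : regMeasures E)
    (F : StrongDual ℝ E) : SeminormCompletion ς × SeminormCompletion ς :=
  ∫ f, complexPair (fourierPhase μ F f) (toCompletion ς f) ∂(μ : ComplexMeasure E).variation

/-- Differentiation under the integral, the derivative being dominated for all `t` by `‖Γ‖ ς(f)`;
the functional `Γ` then comes out of the Bochner integral. -/
theorem isTotalDifferential_measureFourier {ς : Seminorm ℝ E} (hς : Continuous ς)
    {μ : regMeasures E} (hμ : μ ∈ momentMeasures ς 1) (F : StrongDual ℝ E) :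
    IsTotalDifferential ς hς (measureFourier μ) F (fourierDifferential ς μ F) := by
  intro Γ
  -- The vanishing shift of `F` matches the integrand of the derivative evaluated at `t = 0`.
  have hval : ((Γ (fourierDifferential ς μ F).1 : ℝ) : ℂ) +
      Complex.I * ((Γ (fourierDifferential ς μ F).2 : ℝ) : ℂ) =
      ∫ f, fourierPhase μ (F + (0 : ℝ) • Γ.comp (toCompletionL ς hς)) f *
        ((Γ (toCompletion ς f) : ℝ) : ℂ) ∂(μ : ComplexMeasure E).variation := by
    rw [← complexExtension_apply, fourierDifferential, ← ContinuousLinearMap.integral_comp_comm _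
      (integrable_complexPair_fourierPhase hς hμ F), zero_smul, add_zero]
    simp only [complexExtension_complexPair]
  rw [hval]
  simp only [measureFourier, cintegral_eq_integral]
  refine (hasDerivAt_integral_of_dominated_loc_of_deriv_le
    (F' := fun t f => fourierPhase μ (F + t • Γ.comp (toCompletionL ς hς)) f *
        ((Γ (toCompletion ς f) : ℝ) : ℂ)) (bound := fun f => ‖Γ‖ * ς f) univ_mem
    (Eventually.of_forall fun t => Measurable.aestronglyMeasurable ?_) ?_
    (Measurable.aestronglyMeasurable ?_) (ae_of_all _ fun f t _ => ?_)
    ((integrable_of_mem_momentMeasures hς hμ).const_mul _) (ae_of_all _ fun f t _ => ?_)).2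
  · exact (Continuous.measurable (by fun_prop)).mul (measurable_phase _)
  · refine Integrable.of_bound (Measurable.aestronglyMeasurable
      ((Continuous.measurable (by fun_prop)).mul (measurable_phase _))) 1 (ae_of_all _ fun f => ?_)
    rw [norm_mul, norm_exp_I_mul_ofReal, norm_phase, one_mul]
  · exact (measurable_fourierPhase μ _).mul (Complex.measurable_ofReal.comp
      (Γ.comp (toCompletionL ς hς)).continuous.measurable)
  · rw [norm_mul, norm_fourierPhase, one_mul, Complex.norm_real, ← norm_toCompletion ς f]
    exact Γ.le_opNorm _
  · have h1 : HasDerivAt (fun t : ℝ => F f + t * Γ (toCompletion ς f)) (Γ (toCompletion ς f)) t := by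
      simpa using ((hasDerivAt_id t).mul_const (Γ (toCompletion ς f))).const_add (F f)
    have h2 := ((h1.ofReal_comp.const_mul Complex.I).cexp).mul_const
      (phase (μ : ComplexMeasure E) f)
    refine h2.congr_deriv ?_
    simp only [fourierPhase]
    change _ = Complex.I * Complex.exp (Complex.I * ((F f + t * Γ (toCompletion ς f) : ℝ) : ℂ)) *
      _ * _
    ring

/-- The two differentials contribute factors `i`, and `i² = -1` cancels the sign in the definition
of the bracket. -/
theorem poissonBracket_measureFourier {σ : LinearMap.BilinForm ℝ E} {ς : Seminorm ℝ E}
    (hς : Continuous ς) {c : ℝ} (hc : ∀ f g, |σ f g| ≤ c * ς f * ς g) {μ ν : regMeasures E}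
    (hμ : μ ∈ momentMeasures ς 1) (hν : ν ∈ momentMeasures ς 1) :
    poissonBracket σ ς hς c hc (measureFourier μ) (measureFourier ν) =
      measureFourier (measureBracket σ μ ν) := by
  ext F
  rw [measureBracket, measureFourier_weightedConv (finDimMeasurable_ofReal_bilinForm σ)
    (integrable_bilinForm σ hς hc hμ hν), poissonBracket,
    (isTotalDifferential_measureFourier hς hμ F).totalDifferential_eq,
    (isTotalDifferential_measureFourier hς hν F).totalDifferential_eq, fourierDifferential,
    fourierDifferential, complexForm_integral_integral _
      (integrable_complexPair_fourierPhase hς hμ F) (integrable_complexPair_fourierPhase hς hν F)]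
  simp only [complexForm_complexPair, completedForm_apply, cintegral_eq_integral,
    ← integral_neg, ← integral_mul_const]
  congr 1
  ext f
  congr 1
  ext g
  simp only [fourierPhase]
  linear_combination (-(Complex.exp (Complex.I * ((F f : ℝ) : ℂ)) *
    Complex.exp (Complex.I * ((F g : ℝ) : ℂ)) * phase (μ : ComplexMeasure E) f *
      phase (ν : ComplexMeasure E) g * ((σ f g : ℝ) : ℂ))) * Complex.I_mul_I

end Differential

end WeylQuantization

theorem mainTheorem4
    {E : Type u} [AddCommGroup E] [Module ℝ E] [TopologicalSpace E] [IsTopologicalAddGroup E]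
    [ContinuousSMul ℝ E] [LocallyConvexSpace ℝ E] [T2Space E] [MeasurableSpace E] [BorelSpace E]
    (σ : LinearMap.BilinForm ℝ E) (hσ : σ.IsAlt)
    (H : {ħ : ℝ // ħ ≠ 0} → Type v) [∀ ħ, NormedAddCommGroup (H ħ)]
    [∀ ħ, InnerProductSpace ℂ (H ħ)] [∀ ħ, CompleteSpace (H ħ)]
    (P : ∀ ħ : {ħ : ℝ // ħ ≠ 0}, MeasureRep σ ħ (H ħ)) :
    -- the twisted convolutions are well-defined products on the measure space
    (∀ (ħ : ℝ) (μ ν : regMeasures E),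
      IsWeightedConv (multiplier σ ħ) μ ν
        (twistedConv σ ħ μ ν)) ∧
    -- the quantization maps are well-defined on the Fourier transformed measures
    (∀ (ħ : {ħ : ℝ // ħ ≠ 0}) (μ : regMeasures E),
      quantMap (P ħ) (measureFourier μ) = (P ħ).toLinearMap μ) ∧
    -- the norm estimate
    (∀ (ħ : {ħ : ℝ // ħ ≠ 0}) (μ : regMeasures E),
      ‖(P ħ).toLinearMap μ‖ ≤ tvNorm μ) ∧
    -- Dirac's condition
    (∀ (ς : Seminorm ℝ E) (hς : Continuous ς) (c : ℝ) (hc : ∀ f g, |σ f g| ≤ c * ς f * ς g),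
      0 < c →
      ∀ μ ∈ momentMeasures ς 1, ∀ ν ∈ momentMeasures ς 1,
        IsWeightedConv (fun f g => ((σ f g : ℝ) : ℂ)) μ ν
          (measureBracket σ μ ν) ∧
        poissonBracket σ ς hς c hc
            (measureFourier μ) (measureFourier ν) =
          measureFourier (measureBracket σ μ ν) ∧
        Tendsto
          (fun ħ : {ħ : ℝ // ħ ≠ 0} =>
            ‖scaledCommutator ħ
                (quantMap (P ħ) (measureFourier μ))
                (quantMap (P ħ) (measureFourier ν)) -
              quantMap (P ħ)
                (poissonBracket σ ς hς c hc
                  (measureFourier μ) (measureFourier ν))‖)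
          (comap Subtype.val (𝓝 (0 : ℝ))) (𝓝 0)) ∧
    -- von Neumann's condition
    (∀ μ ν : regMeasures E,
      Tendsto
        (fun ħ : {ħ : ℝ // ħ ≠ 0} =>
          ‖quantMap (P ħ) (measureFourier μ) *
              quantMap (P ħ) (measureFourier ν) -
            quantMap (P ħ)
              (measureFourier μ * measureFourier ν)‖)
        (comap Subtype.val (𝓝 (0 : ℝ))) (𝓝 0)) := by
  refine ⟨fun ħ μ ν => isWeightedConv_twistedConv σ ħ μ ν,
    fun ħ μ => quantMap_measureFourier (P ħ) μ, fun ħ μ => (P ħ).norm_le μ,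
    fun ς hς c hc _ μ hμ ν hν => ?_, fun μ ν => tendsto_vonNeumann σ H P μ ν⟩
  have hi := integrable_bilinForm σ hς hc hμ hν
  have hp := poissonBracket_measureFourier hς hc hμ hν
  refine ⟨isWeightedConv_weightedConv (finDimMeasurable_ofReal_bilinForm σ) hi, hp, ?_⟩
  rw [hp]
  exact tendsto_dirac hσ H P hi
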